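/- Let $G$ be a connected semisimple real algebraic group, that is, a topological group isomorphic to an open subgroup (in the Euclidean topology) of the group of real points of a Zariski-connected semisimple linear algebraic group over $\mathbb R$ (for instance the whole group of real points, or its identity component). Let $dg$ be a Haar measure on $G$. A unitary representation $(\pi,\mathcal H)$ of $G$ is called tempered if it is weakly contained in the right regular representation $L^2(G,dg)$, i.e. every diagonal matrix coefficient $g\mapsto\langle \pi(g)v,v\rangle$, $v\in\mathcal H$, is a limit, uniformly on compact subsets of $G$, of convex combinations of diagonal matrix coefficients of $L^2(G,dg)$. A closed unimodular subgroup $H<G$ is called tempered if the quasi-regular representation of $G$ by right translations on $L^2(H\backslash G)$, taken with respect to the nonzero $G$-invariant Radon measure on $H\backslash G$ (unique up to scaling), is tempered. A closed subgroup $H$ is the Chabauty limit of a sequence of closed subgroups $\Gamma_n$ of $G$ if every $h\in H$ is the limit of some sequence $h_n\in\Gamma_n$, and all limit points of every sequence $g_n\in\Gamma_n$ belong to $H$. Theorem. Let $(\Gamma_n)_{n\in\mathbb N}$ be a sequence of tempered discrete subgroups of $G$, and let $H$ be a closed subgroup of $G$ which is the Chabauty limit of $(\Gamma_n)$. Then $H$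 is unimodular, and $H$ is a tempered subgroup of $G$. -/

import Mathlib

open MeasureTheory Filter Topology
open scoped ENNReal

noncomputable section

/-! ### Unitary representations, weak containment -/

/-- A (strongly continuous) unitary representation of `G` on a complex inner product space `V`. -/
structure UnitaryRep (G : Type*) [Group G] [TopologicalSpace G]
    (V : Type*) [NormedAddCommGroup V] [InnerProductSpace ℂ V] where
  /-- the action by unitary operators -/
  toHom : G →* (V ≃ₗᵢ[ℂ] V)
  /-- strong continuity -/
  continuous_apply : ∀ v : V, Continuous fun g : G => toHom g v

namespace UnitaryRep

variable {G : Type*} [Group G] [TopologicalSpace G]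
  {V : Type*} [NormedAddCommGroup V] [InnerProductSpace ℂ V]
  {W : Type*} [NormedAddCommGroup W] [InnerProductSpace ℂ W]

/-- The diagonal matrix coefficient `g ↦ ⟨π(g) v, v⟩` (Mathlib's inner product is linear in its
second argument). -/
def diagCoeff (π : UnitaryRep G V) (v : V) : G → ℂ := fun g => inner ℂ v (π.toHom g v)

/-- `π` is weakly contained in `σ`: every diagonal matrix coefficient of `π` is approximated,
uniformly on compact subsets of `G`, by convex combinations of diagonal matrix coefficients
of `σ`. -/
def WeaklyContainedIn (π : UnitaryRep G V) (σ : UnitaryRep G W) : Prop :=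
  ∀ v : V, ∀ Q : Set G, IsCompact Q → ∀ ε : ℝ, 0 < ε →
    ∃ φ ∈ convexHull ℝ (Set.range σ.diagCoeff), ∀ g ∈ Q, ‖π.diagCoeff v g - φ g‖ < ε

end UnitaryRep

/-! ### Right translation on `L²` -/

section RightTranslation

variable {G : Type*} [Group G] [TopologicalSpace G]
  {X : Type*} [TopologicalSpace X] [R1Space X] [MeasurableSpace X] [BorelSpace X]
  [MulAction Gᵐᵒᵖ X] [ContinuousSMul Gᵐᵒᵖ X]

/-- For a right action of `G` on `X` (that is, an action of `Gᵐᵒᵖ`) preserving the Radon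
measure `μ`, the unitary representation of `G` on `L²(X, μ)` by right translations, `(g • f)(x) = f(x g)`.
-/
def rightTranslationRep (μ : Measure X) [μ.Regular] [IsLocallyFiniteMeasure μ]
    [SMulInvariantMeasure Gᵐᵒᵖ X μ] :
    UnitaryRep G (Lp ℂ 2 μ) where
  toHom :=
    { toFun := fun g =>
        { toFun := fun f => DomMulAct.mk (MulOpposite.op g) • f
          invFun := fun f => DomMulAct.mk (MulOpposite.op g⁻¹) • f
          map_add' := fun f₁ f₂ => smul_add _ f₁ f₂
          map_smul' := fun c f => smul_comm _ c f
          left_inv := fun f => by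
            change DomMulAct.mk (MulOpposite.op g⁻¹) • DomMulAct.mk (MulOpposite.op g) • f = f
            rw [smul_smul, ← DomMulAct.mk_mul, ← MulOpposite.op_mul, inv_mul_cancel,
              MulOpposite.op_one, DomMulAct.mk_one, one_smul]
          right_inv := fun f => by
            change DomMulAct.mk (MulOpposite.op g) • DomMulAct.mk (MulOpposite.op g⁻¹) • f = f
            rw [smul_smul, ← DomMulAct.mk_mul, ← MulOpposite.op_mul, mul_inv_cancel,
              MulOpposite.op_one, DomMulAct.mk_one, one_smul]
          norm_map' := fun f => DomMulAct.norm_smul_Lp _ f }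
      map_one' := by
        ext1 f
        exact one_smul (Gᵐᵒᵖ)ᵈᵐᵃ f
      map_mul' := fun g h => by
        ext1 f
        change DomMulAct.mk (MulOpposite.op (g * h)) • f
          = DomMulAct.mk (MulOpposite.op g) • DomMulAct.mk (MulOpposite.op h) • f
        rw [smul_smul, ← DomMulAct.mk_mul, ← MulOpposite.op_mul] }
  continuous_apply := fun f => by
    let _ : MeasurableSpace Gᵐᵒᵖ := borel Gᵐᵒᵖ
    have : BorelSpace Gᵐᵒᵖ := ⟨rfl⟩
    have : Fact ((2 : ℝ≥0∞) ≠ ∞) := ⟨by norm_num⟩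
    have h : Continuous fun g : G => DomMulAct.mk (MulOpposite.op g) :=
      DomMulAct.continuous_mk.comp MulOpposite.continuous_op
    exact h.smul continuous_const

/-- The representation above is indeed given by right translations. -/
theorem rightTranslationRep_ae_eq (μ : Measure X) [μ.Regular] [IsLocallyFiniteMeasure μ]
    [SMulInvariantMeasure Gᵐᵒᵖ X μ] (g : G) (f : Lp ℂ 2 μ) :
    ((rightTranslationRep μ).toHom g f : X → ℂ) =ᵐ[μ] fun x => f (MulOpposite.op g • x) :=
  DomMulAct.smul_Lp_ae_eq _ f

end RightTranslation

/-! ### The space `H \ G` of right cosets -/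

/-- The space `H \ G` of right cosets `H g`. -/
def RightCosets {G : Type*} [Group G] (H : Subgroup G) : Type _ :=
  Quotient (QuotientGroup.rightRel H)

namespace RightCosets

variable {G : Type*} [Group G] {H : Subgroup G}

/-- The projection `g ↦ H g`. -/
def mk (H : Subgroup G) (g : G) : RightCosets H := Quotient.mk (QuotientGroup.rightRel H) g

theorem mk_surjective : Function.Surjective (mk H) := Quotient.mk_surjective

theorem mk_eq_mk {a b : G} : mk H a = mk H b ↔ b * a⁻¹ ∈ H := by
  rw [← QuotientGroup.rightRel_apply]
  exact Quotient.eq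

/-- The right action `(H x) g = H x g` of `G` on `H \ G`, written as an action of `Gᵐᵒᵖ`. -/
instance : MulAction Gᵐᵒᵖ (RightCosets H) where
  smul g := Quotient.map (fun x => x * g.unop) (by
    intro a b hab
    have hab' := QuotientGroup.rightRel_apply.1 hab
    refine QuotientGroup.rightRel_apply.2 ?_
    simpa [mul_assoc] using hab')
  one_smul x := by
    obtain ⟨x, rfl⟩ := mk_surjective x
    exact congrArg (mk H) (mul_one x)
  mul_smul g h x := by
    obtain ⟨x, rfl⟩ := mk_surjective x
    exact congrArg (mk H) (mul_assoc x h.unop g.unop).symm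

theorem op_smul_mk (g x : G) : MulOpposite.op g • mk H x = mk H (x * g) := rfl

variable [TopologicalSpace G]

/-- The quotient topology on `H \ G`. -/
instance : TopologicalSpace (RightCosets H) :=
  inferInstanceAs (TopologicalSpace (Quotient (QuotientGroup.rightRel H)))

/-- The Borel sigma-algebra on `H \ G`. -/
instance : MeasurableSpace (RightCosets H) := borel _

instance : BorelSpace (RightCosets H) := ⟨rfl⟩

theorem isQuotientMap_mk : IsQuotientMap (mk H) := isQuotientMap_quotient_mk'

variable [IsTopologicalGroup G]

theorem isOpenQuotientMap_mk : IsOpenQuotientMap (mk H) :=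
  MulAction.isOpenQuotientMap_quotientMk (Γ := H) (T := G)

instance : ContinuousSMul Gᵐᵒᵖ (RightCosets H) where
  continuous_smul := by
    have hq : IsOpenQuotientMap (Prod.map (id : Gᵐᵒᵖ → Gᵐᵒᵖ) (mk H)) :=
      IsOpenQuotientMap.id.prodMap isOpenQuotientMap_mk
    refine hq.isQuotientMap.continuous_iff.2 ?_
    have h : Continuous fun p : Gᵐᵒᵖ × G => p.2 * p.1.unop :=
      continuous_snd.mul (MulOpposite.continuous_unop.comp continuous_fst)
    exact isQuotientMap_mk.continuous.comp h

instance : RegularSpace (RightCosets H) := by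
  refine RegularSpace.of_exists_mem_nhds_isClosed_subset fun x U hU => ?_
  obtain ⟨x, rfl⟩ := mk_surjective x
  have hc : Tendsto (fun p : G × G => mk H (x * p.1 * p.2⁻¹)) (𝓝 (1, 1)) (𝓝 (mk H x)) := by
    have h : Continuous fun p : G × G => mk H (x * p.1 * p.2⁻¹) :=
      isQuotientMap_mk.continuous.comp (by fun_prop)
    simpa using h.tendsto (1, 1)
  have hW := hc hU
  rw [nhds_prod_eq, mem_map, mem_prod_same_iff] at hW
  obtain ⟨V, hV, hVU⟩ := hW
  refine ⟨closure (mk H '' ((fun v => x * v) '' V)), ?_, isClosed_closure, ?_⟩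
  · refine mem_of_superset (isOpenQuotientMap_mk.isOpenMap.image_mem_nhds ?_) subset_closure
    simpa using (Homeomorph.mulLeft x).isOpenMap.image_mem_nhds hV
  · intro y hy
    obtain ⟨y, rfl⟩ := mk_surjective y
    have hyV : mk H '' ((fun v => y * v) '' V) ∈ 𝓝 (mk H y) := by
      refine isOpenQuotientMap_mk.isOpenMap.image_mem_nhds ?_
      simpa using (Homeomorph.mulLeft y).isOpenMap.image_mem_nhds hV
    obtain ⟨_, ⟨_, ⟨v, hv, rfl⟩, rfl⟩, ⟨_, ⟨w, hw, rfl⟩, h⟩⟩ :=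
      mem_closure_iff_nhds.1 hy _ hyV
    have h1 : mk H y = mk H (x * w * v⁻¹) := by
      have h2 := congrArg (fun z => MulOpposite.op v⁻¹ • z) h
      simp only [op_smul_mk] at h2
      simpa using h2.symm
    rw [h1]
    exact hVU (Set.mk_mem_prod hw hv)

end RightCosets

/-! ### Unimodular and tempered subgroups -/

section Subgroups

variable {G : Type*} [Group G] [TopologicalSpace G] [IsTopologicalGroup G]
  [MeasurableSpace G] [BorelSpace G]

/-- A unitary representation of the (unimodular) group `G` is tempered if it is weakly contained
in the right regular representation on `L²(G, dg)`, where `dg` is a Haar measure on `G`; the choice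
of `dg` is immaterial. -/
def UnitaryRep.IsTempered {V : Type*} [NormedAddCommGroup V] [InnerProductSpace ℂ V]
    (π : UnitaryRep G V) : Prop :=
  ∃ (dg : Measure G) (_ : dg.IsHaarMeasure) (_ : dg.IsMulRightInvariant) (_ : dg.Regular)
    (_ : IsLocallyFiniteMeasure dg),
    π.WeaklyContainedIn (rightTranslationRep (G := G) dg)

/-- A subgroup is unimodular if it carries a Haar measure which is both left- and
right-invariant. -/
def IsUnimodularSubgroup (H : Subgroup G) : Prop :=
  ∃ ν : Measure H, ν.IsHaarMeasure ∧ ν.IsMulRightInvariant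

/-- `H` is a tempered subgroup of `G` if the quasi-regular representation of `G` on `L²(H \ G)`,
with respect to the nonzero `G`-invariant Radon measure on `H \ G` (unique up to scaling), is
tempered. -/
def IsTemperedSubgroup (H : Subgroup G) : Prop :=
  ∃ (μ : Measure (RightCosets H)) (_ : μ.Regular) (_ : IsLocallyFiniteMeasure μ)
    (_ : SMulInvariantMeasure Gᵐᵒᵖ (RightCosets H) μ),
    μ ≠ 0 ∧ (rightTranslationRep (G := G) μ).IsTempered

/-- `H` is the Chabauty limit of the sequence of subgroups `Γ n`: every element of `H` is a limit
of elements of the `Γ n`, and all limit points of sequences `g n ∈ Γ n` lie in `H`. -/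
def ChabautyTendsto (Γ : ℕ → Subgroup G) (H : Subgroup G) : Prop :=
  (∀ h ∈ H, ∃ γ : ℕ → G, (∀ n, γ n ∈ Γ n) ∧ Tendsto γ atTop (𝓝 h)) ∧
    ∀ g : ℕ → G, (∀ n, g n ∈ Γ n) → ∀ x : G, MapClusterPt x atTop g → x ∈ H

end Subgroups

/-! ### Semisimple real algebraic groups -/

section Algebraic

variable {N : ℕ}

/-- A subgroup of `GL_N(ℝ)` is Zariski closed if it is cut out in `GL_N(ℝ)` by polynomial equations
in the matrix entries. -/
def IsZariskiClosed (A : Subgroup (GL (Fin N) ℝ)) : Prop :=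
  ∃ S : Set (MvPolynomial (Fin N × Fin N) ℝ), ∀ g : GL (Fin N) ℝ,
    g ∈ A ↔ ∀ p ∈ S, MvPolynomial.eval (fun ij => (g : Matrix (Fin N) (Fin N) ℝ) ij.1 ij.2) p = 0

/-- A Zariski closed subgroup of `GL_N(ℝ)` is connected (in the Zariski topology) if it has no
proper Zariski closed subgroup of finite index. -/
def IsZariskiConnected (A : Subgroup (GL (Fin N) ℝ)) : Prop :=
  ∀ B : Subgroup (GL (Fin N) ℝ), B ≤ A → IsZariskiClosed B → B.IsFiniteRelIndex A → B = A

/-- A connected semisimple algebraic subgroup of `GL_N(ℝ)`: Zariski closed, Zariski connected, and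
with trivial radical, i.e. without nontrivial Zariski connected, Zariski closed, solvable, normal
subgroups. -/
structure IsConnectedSemisimpleAlgebraic (A : Subgroup (GL (Fin N) ℝ)) : Prop where
  isZariskiClosed : IsZariskiClosed A
  isZariskiConnected : IsZariskiConnected A
  radical_eq_bot : ∀ R : Subgroup (GL (Fin N) ℝ), R ≤ A → (R.subgroupOf A).Normal →
    IsZariskiClosed R → IsZariskiConnected R → Group.IsSolvable R → R = ⊥

end Algebraic

/-- The topological group `G` is a connected semisimple real algebraic group: it is isomorphic to
an open subgroup (in the Euclidean topology) of the group of real points of a connected semisimple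
linear algebraic group over `ℝ`. This covers the full group of real points as well as its identity
component, such as `SO(p,q)` and `SO°(p,q)`
for `p + q ≥ 3`. -/
def IsConnectedSemisimpleRealAlgebraicGroup (G : Type*) [Group G] [TopologicalSpace G] : Prop :=
  ∃ (N : ℕ) (A : Subgroup (GL (Fin N) ℝ)) (ρ : G →* A),
    IsConnectedSemisimpleAlgebraic A ∧ IsOpenEmbedding ρ

end

/-!
Let `ν n` be Haar measures of the groups `Γ n`, normalised to give a fixed compact neighbourhood of
the identity mass one. They are uniformly bounded on compact sets, so along an ultrafilter they
converge vaguely to a measure on `G`. Chabauty convergence forces the limit to live on `H` and to be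
invariant under left translation by `H`; it is also inversion-invariant, as all the `ν n` are. So it
is a Haar measure `ν'` of `H`, and `H` is unimodular.

By Weil's formula, a function `φ` in `C_c(G)` yields a vector of `L²(H \ G)` with matrix coefficient
`g ↦ ∫_H ∫_G conj(φ(x)) φ(h x g) dx dν'(h)`, and such vectors are dense. This coefficient is the
limit, uniformly on compact sets, of the corresponding coefficients of `L²(Γ n \ G)`, and these are
limits of convex combinations of coefficients of `L²(G)` because `Γ n` is tempered.
-/

noncomputable section

/-! ### The topology of `G` and of `H \ G` -/

section Topology

theorem IsZariskiClosed.isClosed {N : ℕ} {A : Subgroup (GL (Fin N) ℝ)} (hA : IsZariskiClosed A) :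
    IsClosed (A : Set (GL (Fin N) ℝ)) := by
  obtain ⟨S, hS⟩ := hA
  have hA_eq : (A : Set (GL (Fin N) ℝ)) = ⋂ p ∈ S, {g : GL (Fin N) ℝ | MvPolynomial.eval
      (fun ij => (g : Matrix (Fin N) (Fin N) ℝ) ij.1 ij.2) p = 0} := by
    ext g
    simpa using hS g
  rw [hA_eq]
  refine isClosed_biInter fun p _ => isClosed_eq ?_ continuous_const
  exact (MvPolynomial.continuous_eval p).comp
    (continuous_pi fun ij => Units.continuous_val.matrix_elem ij.1 ij.2)

namespace IsConnectedSemisimpleRealAlgebraicGroup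

variable {G : Type*} [Group G] [TopologicalSpace G]

theorem t2Space (hG : IsConnectedSemisimpleRealAlgebraicGroup G) : T2Space G := by
  obtain ⟨N, A, ρ, -, hρ⟩ := hG
  exact hρ.isEmbedding.t2Space

theorem locallyCompactSpace (hG : IsConnectedSemisimpleRealAlgebraicGroup G) :
    LocallyCompactSpace G := by
  obtain ⟨N, A, ρ, hA, hρ⟩ := hG
  have : LocallyCompactSpace (Matrix (Fin N) (Fin N) ℝ) :=
    inferInstanceAs (LocallyCompactSpace (Fin N → Fin N → ℝ))
  have : LocallyCompactSpace A :=
    hA.isZariskiClosed.isClosed.isClosedEmbedding_subtypeVal.locallyCompactSpace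
  exact hρ.locallyCompactSpace

end IsConnectedSemisimpleRealAlgebraicGroup

namespace RightCosets

variable {G : Type*} [Group G] [TopologicalSpace G] {H : Subgroup G}

@[fun_prop]
theorem continuous_mk : Continuous (mk H) := isQuotientMap_mk.continuous

omit [TopologicalSpace G] in
theorem mk_mul_of_mem {h : G} (hh : h ∈ H) (x : G) : mk H (h * x) = mk H x :=
  mk_eq_mk.2 (by simpa using H.inv_mem hh)

variable [IsTopologicalGroup G]

theorem t2Space (hH : IsClosed (H : Set G)) : T2Space (RightCosets H) := by
  have : T1Space (RightCosets H) := by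
    refine ⟨fun q => ?_⟩
    obtain ⟨x, rfl⟩ := mk_surjective q
    have h_fiber : mk H ⁻¹' {mk H x} = (fun y => x * y⁻¹) ⁻¹' H := by
      ext y
      simp [mk_eq_mk]
    rw [← isQuotientMap_mk.isClosed_preimage, h_fiber]
    exact hH.preimage (by fun_prop)
  infer_instance

variable [LocallyCompactSpace G]

instance : LocallyCompactSpace (RightCosets H) :=
  isOpenQuotientMap_mk.locallyCompactSpace

theorem exists_isCompact_subset_image_mk {K : Set (RightCosets H)} (hK : IsCompact K) :
    ∃ C : Set G, IsCompact C ∧ K ⊆ mk H '' C := by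
  have h_local : ∀ q : RightCosets H, ∃ C : Set G, IsCompact C ∧ mk H '' C ∈ 𝓝 q := fun q => by
    obtain ⟨x, rfl⟩ := mk_surjective q
    obtain ⟨C, hC, hx⟩ := exists_compact_mem_nhds x
    exact ⟨C, hC, isOpenQuotientMap_mk.isOpenMap.image_mem_nhds hx⟩
  choose C hC hCn using h_local
  obtain ⟨t, -, ht⟩ := hK.elim_nhds_subcover (fun q => mk H '' C q) fun q _ => hCn q
  refine ⟨⋃ q ∈ t, C q, t.isCompact_biUnion fun q _ => hC q, ht.trans ?_⟩
  simp only [Set.image_iUnion, subset_rfl]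

end RightCosets

end Topology

/-! ### Haar measures of unimodular groups -/

section UnimodularGroup

open NNReal

variable {G : Type*} [Group G] [TopologicalSpace G] [IsTopologicalGroup G]
  [MeasurableSpace G] [BorelSpace G]

instance (priority := 100) isMulRightInvariant_of_isInvInvariant (μ : Measure G)
    [μ.IsMulLeftInvariant] [μ.IsInvInvariant] : μ.IsMulRightInvariant := by
  rw [← Measure.inv_eq_self μ]
  infer_instance

variable [LocallyCompactSpace G]

theorem isMulRightInvariant_haar_of_isMulRightInvariant (μ : Measure G) [μ.IsHaarMeasure]
    [μ.IsMulRightInvariant] : (Measure.haar : Measure G).IsMulRightInvariant := by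
  refine ⟨fun g => ?_⟩
  have h_char : Measure.modularCharacterFun g = 1 := by
    simp only [Measure.modularCharacterFun_eq_haarScalarFactor μ, map_mul_right_eq_self,
      Measure.haarScalarFactor_self]
  have : (Measure.map (· * g) (Measure.haar : Measure G)).Regular :=
    Measure.Regular.map (Homeomorph.mulRight g)
  rw [Measure.isMulLeftInvariant_eq_smul_of_regular (Measure.map (· * g) Measure.haar)
    Measure.haar, ← Measure.modularCharacterFun_eq_haarScalarFactor, h_char, one_smul]

theorem isInvInvariant_of_isMulRightInvariant (μ : Measure G) [μ.IsHaarMeasure]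
    [μ.IsMulRightInvariant] [μ.Regular] : μ.IsInvInvariant := by
  refine ⟨?_⟩
  set c := μ.inv.haarScalarFactor μ
  have h_inv : μ.inv = c • μ := Measure.isMulLeftInvariant_eq_smul_of_regular μ.inv μ
  obtain ⟨K, hK, hK1⟩ := exists_compact_mem_nhds (1 : G)
  have hL : IsCompact (K ∪ K⁻¹) := hK.union hK.inv
  have hL_pos : μ (K ∪ K⁻¹) ≠ 0 :=
    (Measure.measure_pos_of_mem_nhds μ (mem_of_superset hK1 (by simp))).ne'
  have h_eval : (c : ℝ≥0∞) * μ (K ∪ K⁻¹) = 1 * μ (K ∪ K⁻¹) := by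
    rw [← smul_eq_mul, ← ENNReal.smul_def, ← Measure.smul_apply, ← h_inv, Measure.inv_apply,
      Set.union_inv, inv_inv, Set.union_comm, one_mul]
  have hc : c = 1 := by
    exact_mod_cast (ENNReal.mul_left_inj hL_pos hL.measure_lt_top.ne).1 h_eval
  rw [h_inv, hc, one_smul]

theorem exists_eq_smul_of_isMulRightInvariant (ρ μ : Measure G) [ρ.IsMulRightInvariant]
    [ρ.Regular] [μ.IsHaarMeasure] [μ.IsMulRightInvariant] [μ.Regular] : ∃ c : ℝ≥0, ρ = c • μ := by
  have := isInvInvariant_of_isMulRightInvariant μ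
  obtain ⟨c, hc⟩ : ∃ c : ℝ≥0, ρ.inv = c • μ :=
    ⟨_, Measure.isMulLeftInvariant_eq_smul_of_regular ρ.inv μ⟩
  refine ⟨c, ?_⟩
  calc ρ = ρ.inv.inv := (Measure.inv_inv ρ).symm
    _ = c • μ.inv := by rw [hc, Measure.inv, Measure.map_smul, Measure.inv]
    _ = c • μ := by rw [Measure.inv_eq_self]

end UnimodularGroup

theorem isUnimodularSubgroup_iff_exists_isInvInvariant {G : Type*} [Group G] [TopologicalSpace G]
    [IsTopologicalGroup G] [LocallyCompactSpace G] [MeasurableSpace G] [BorelSpace G]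
    {H : Subgroup G} (hH : IsClosed (H : Set G)) :
    IsUnimodularSubgroup H ↔ ∃ ν : Measure H, ν.IsHaarMeasure ∧ ν.IsInvInvariant := by
  have : LocallyCompactSpace H := hH.isClosedEmbedding_subtypeVal.locallyCompactSpace
  constructor
  · rintro ⟨ν, _, _⟩
    have := isMulRightInvariant_haar_of_isMulRightInvariant ν
    exact ⟨Measure.haar, inferInstance, isInvInvariant_of_isMulRightInvariant Measure.haar⟩
  · rintro ⟨ν, hν, _⟩
    exact ⟨ν, hν, inferInstance⟩

/-! ### Integration over cosets -/

section CosetIntegral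

open CompactlySupported Pointwise

variable {G : Type*} [Group G] [MeasurableSpace G] {H : Subgroup G}
  {E : Type*} [NormedAddCommGroup E] [NormedSpace ℝ E] {ν : Measure H}

/-- The function `H x ↦ ∫_H φ(h x) dν(h)` on `H \ G`. It is defined through representatives of the
cosets; by `cosetIntegral_mk` the choice is immaterial when `ν` is right-invariant. -/
def cosetIntegral (ν : Measure H) (φ : G → E) (q : RightCosets H) : E :=
  ∫ h : H, φ (h * Quotient.out q) ∂ν

theorem cosetIntegral_mk [MeasurableMul H] [ν.IsMulRightInvariant] (φ : G → E) (x : G) :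
    cosetIntegral ν φ (RightCosets.mk H x) = ∫ h : H, φ (h * x) ∂ν := by
  set y := Quotient.out (RightCosets.mk H x)
  have hy : x * y⁻¹ ∈ H := RightCosets.mk_eq_mk.1 (Quotient.out_eq _)
  calc ∫ h : H, φ (h * y) ∂ν = ∫ h : H, φ ((h * ⟨x * y⁻¹, hy⟩ : H) * y) ∂ν :=
        (integral_mul_right_eq_self (fun h : H => φ (h * y)) ⟨x * y⁻¹, hy⟩).symm
    _ = ∫ h : H, φ (h * x) ∂ν := by simp [mul_assoc]

theorem cosetIntegral_comp_mul_right [MeasurableMul H] [ν.IsMulRightInvariant] (φ : G → E) (g : G)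
    (q : RightCosets H) :
    cosetIntegral ν (fun x => φ (x * g)) q = cosetIntegral ν φ (MulOpposite.op g • q) := by
  obtain ⟨x, rfl⟩ := RightCosets.mk_surjective q
  simp only [RightCosets.op_smul_mk, cosetIntegral_mk, mul_assoc]

theorem cosetIntegral_smul_comp_mk [CompleteSpace E] {𝕜 : Type*} [RCLike 𝕜] [NormedSpace 𝕜 E]
    (φ : G → 𝕜) (f : RightCosets H → E) (q : RightCosets H) :
    cosetIntegral ν (fun x => φ x • f (RightCosets.mk H x)) q = cosetIntegral ν φ q • f q := by
  have hq (h : H) : RightCosets.mk H (h * Quotient.out q) = q :=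
    (RightCosets.mk_mul_of_mem h.2 _).trans (Quotient.out_eq q)
  simp only [cosetIntegral, hq, integral_smul_const]

variable [TopologicalSpace G] [IsTopologicalGroup G]

omit [MeasurableSpace G] [NormedSpace ℝ E] in
theorem hasCompactSupport_comp_coe_mul (hH : IsClosed (H : Set G)) {φ : G → E}
    (hφc : HasCompactSupport φ) (x : G) : HasCompactSupport fun h : H => φ (h * x) :=
  hφc.comp_isClosedEmbedding
    ((Homeomorph.mulRight x).isClosedEmbedding.comp hH.isClosedEmbedding_subtypeVal)

variable [BorelSpace G]

theorem hasCompactSupport_cosetIntegral [ν.IsMulRightInvariant] (hH : IsClosed (H : Set G))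
    {φ : G → E} (hφc : HasCompactSupport φ) : HasCompactSupport (cosetIntegral ν φ) := by
  have := RightCosets.t2Space hH
  refine HasCompactSupport.intro (hφc.isCompact.image (RightCosets.continuous_mk (H := H)))
    fun q hq => ?_
  obtain ⟨x, rfl⟩ := RightCosets.mk_surjective q
  rw [cosetIntegral_mk]
  refine integral_eq_zero_of_ae (Eventually.of_forall fun h => ?_)
  by_contra hne
  exact hq ⟨h * x, subset_tsupport _ hne, RightCosets.mk_mul_of_mem h.2 x⟩

variable [IsFiniteMeasureOnCompacts ν]

theorem cosetIntegral_add (hH : IsClosed (H : Set G)) {φ ψ : G → E} (hφ : Continuous φ)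
    (hφc : HasCompactSupport φ) (hψ : Continuous ψ) (hψc : HasCompactSupport ψ) :
    cosetIntegral ν (φ + ψ) = cosetIntegral ν φ + cosetIntegral ν ψ :=
  funext fun q => integral_add
    ((by fun_prop : Continuous fun h : H => φ (h * q.out)).integrable_of_hasCompactSupport
      (hasCompactSupport_comp_coe_mul hH hφc q.out))
    ((by fun_prop : Continuous fun h : H => ψ (h * q.out)).integrable_of_hasCompactSupport
      (hasCompactSupport_comp_coe_mul hH hψc q.out))

variable [LocallyCompactSpace G] [ν.IsMulRightInvariant]

theorem continuous_cosetIntegral (hH : IsClosed (H : Set G)) {φ : G → E} (hφ : Continuous φ)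
    (hφc : HasCompactSupport φ) : Continuous (cosetIntegral ν φ) := by
  refine RightCosets.isQuotientMap_mk.continuous_iff.2 (continuous_iff_continuousAt.2 fun x₀ => ?_)
  obtain ⟨C, hC, hx₀⟩ := exists_compact_mem_nhds x₀
  have hL : IsCompact ((↑) ⁻¹' (tsupport φ * C⁻¹) : Set H) :=
    hH.isClosedEmbedding_subtypeVal.isCompact_preimage (hφc.isCompact.mul hC.inv)
  have h_supp : ∀ x h, x ∈ C → h ∉ ((↑) ⁻¹' (tsupport φ * C⁻¹) : Set H) → φ (h * x) = 0 := by
    intro x h hx hh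
    by_contra hne
    exact hh ⟨h * x, subset_tsupport _ hne, x⁻¹, Set.inv_mem_inv.2 hx, by simp⟩
  have h_on : ContinuousOn (fun x => ∫ h : H, φ (h * x) ∂ν) C :=
    continuousOn_integral_of_compact_support hL (by fun_prop) h_supp
  exact (h_on.continuousAt hx₀).congr (Eventually.of_forall fun x => (cosetIntegral_mk φ x).symm)

variable [ν.IsOpenPosMeasure]

theorem exists_cosetIntegral_eq_one (hH : IsClosed (H : Set G)) {K : Set (RightCosets H)}
    (hK : IsCompact K) : ∃ θ : G → ℝ, Continuous θ ∧ HasCompactSupport θ ∧ 0 ≤ θ ∧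
      ∀ q ∈ K, cosetIntegral ν θ q = 1 := by
  obtain ⟨C, hC, hKC⟩ := RightCosets.exists_isCompact_subset_image_mk hK
  obtain ⟨η, hηC, -, hηc, hη01⟩ :=
    exists_continuous_one_zero_of_isCompact hC isClosed_empty (Set.disjoint_empty C)
  have hηi : Continuous (cosetIntegral ν η) := continuous_cosetIntegral hH η.continuous hηc
  have h_pos : ∀ q ∈ K, 0 < cosetIntegral ν η q := by
    intro q hq
    obtain ⟨x, hx, rfl⟩ := hKC hq
    rw [cosetIntegral_mk]
    refine Continuous.integral_pos_of_hasCompactSupport_nonneg_nonzero (x := 1) (by fun_prop)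
      (hasCompactSupport_comp_coe_mul hH hηc x) (fun h => (hη01 _).1) ?_
    simp [hηC hx]
  obtain ⟨δ, hδ, hδK⟩ := hK.exists_forall_le' hηi.continuousOn h_pos
  have h_max (q) : max (cosetIntegral ν η q) δ ≠ 0 := (lt_max_of_lt_right hδ).ne'
  refine ⟨fun x => η x • (max (cosetIntegral ν η (RightCosets.mk H x)) δ)⁻¹, ?_, hηc.smul_right,
    fun x => ?_, fun q hq => ?_⟩
  · exact η.continuous.smul (((hηi.comp RightCosets.continuous_mk).max continuous_const).inv₀
      fun x => h_max _)
  · exact mul_nonneg (hη01 x).1 (inv_nonneg.2 (hδ.le.trans (le_max_right _ _)))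
  · rw [cosetIntegral_smul_comp_mk (f := fun q => (max (cosetIntegral ν η q) δ)⁻¹),
      max_eq_left (hδK q hq), smul_eq_mul, mul_inv_cancel₀ (h_pos q hq).ne']

theorem exists_cosetIntegral_smul_comp_mk_eq [CompleteSpace E] (hH : IsClosed (H : Set G))
    {f : RightCosets H → E} (hfc : HasCompactSupport f) :
    ∃ θ : G → ℝ, Continuous θ ∧ HasCompactSupport θ ∧ 0 ≤ θ ∧
      cosetIntegral ν (fun x => θ x • f (RightCosets.mk H x)) = f := by
  obtain ⟨θ, hθ, hθc, hθ0, hθf⟩ := exists_cosetIntegral_eq_one (ν := ν) hH hfc.isCompact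
  refine ⟨θ, hθ, hθc, hθ0, funext fun q => ?_⟩
  rw [cosetIntegral_smul_comp_mk]
  by_cases hq : q ∈ tsupport f
  · rw [hθf q hq, one_smul]
  · rw [image_eq_zero_of_notMem_tsupport hq, smul_zero]

/-- `cosetIntegral` as a linear map between spaces of compactly supported continuous functions. -/
def cosetIntegralLinearMap (hH : IsClosed (H : Set G)) (ν : Measure H)
    [IsFiniteMeasureOnCompacts ν] [ν.IsMulRightInvariant] :
    C_c(G, ℝ) →ₗ[ℝ] C_c(RightCosets H, ℝ) where
  toFun φ := ⟨⟨cosetIntegral ν φ, continuous_cosetIntegral hH (map_continuous φ)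
    φ.hasCompactSupport⟩, hasCompactSupport_cosetIntegral hH φ.hasCompactSupport⟩
  map_add' φ ψ := DFunLike.coe_injective <| cosetIntegral_add hH (map_continuous φ)
    φ.hasCompactSupport (map_continuous ψ) ψ.hasCompactSupport
  map_smul' c φ := DFunLike.coe_injective <| funext fun q =>
    integral_const_mul c fun h : H => φ (h * q.out)

theorem exists_cosetIntegralLinearMap_eq (hH : IsClosed (H : Set G)) (f : C_c(RightCosets H, ℝ)) :
    ∃ φ : C_c(G, ℝ), cosetIntegralLinearMap hH ν φ = f ∧ (0 ≤ f → 0 ≤ φ) := by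
  obtain ⟨θ, hθ, hθc, hθ0, hθf⟩ :=
    exists_cosetIntegral_smul_comp_mk_eq (ν := ν) hH f.hasCompactSupport
  exact ⟨⟨⟨_, hθ.smul ((map_continuous f).comp RightCosets.continuous_mk)⟩, hθc.smul_right⟩,
    DFunLike.coe_injective hθf, fun hf x => mul_nonneg (hθ0 x) (hf _)⟩

end CosetIntegral

/-! ### Regular measures as functionals on `C_c(X, ℝ)` -/

section RegularMeasure

open CompactlySupported

variable {X : Type*} [TopologicalSpace X] [T2Space X] [LocallyCompactSpace X] [MeasurableSpace X]
  [BorelSpace X]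

theorem exists_regular_integral_eq (Λ : C_c(X, ℝ) →ₗ[ℝ] ℝ) (hΛ : ∀ f, 0 ≤ f → 0 ≤ Λ f) :
    ∃ μ : Measure X, μ.Regular ∧ ∀ f : C_c(X, ℝ), ∫ x, f x ∂μ = Λ f :=
  ⟨RealRMK.rieszMeasure (PositiveLinearMap.mk₀ Λ hΛ), inferInstance,
    RealRMK.integral_rieszMeasure _⟩

theorem map_homeomorph_eq_self_of_integral_comp_eq {μ : Measure X} [μ.Regular] (e : X ≃ₜ X)
    (he : ∀ f : C_c(X, ℝ), ∫ x, f (e x) ∂μ = ∫ x, f x ∂μ) : μ.map e = μ := by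
  have : (μ.map e).Regular := Measure.Regular.map e
  refine Measure.ext_of_integral_eq_on_compactlySupported fun f => ?_
  rw [integral_map e.continuous.aemeasurable (map_continuous f).aestronglyMeasurable, he f]

end RegularMeasure

/-! ### Weil's integration formula -/

section WeilIntegration

open CompactlySupported ComplexConjugate NNReal Pointwise

variable {G : Type*} [Group G] [TopologicalSpace G] [MeasurableSpace G] {H : Subgroup G}
  {ν : Measure H} {dg : Measure G} {μ : Measure (RightCosets H)}

/-- Weil's formula `∫_{H \ G} ∫_H φ(h x) dν(h) dμ(H x) = ∫_G φ dg`, which characterises the quotient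
`μ` of the Haar measure `dg` of `G` by the Haar measure `ν` of `H`. -/
def WeilFormula (ν : Measure H) (dg : Measure G) (μ : Measure (RightCosets H)) : Prop :=
  ∀ φ : C_c(G, ℝ), ∫ q, cosetIntegral ν φ q ∂μ = ∫ x, φ x ∂dg

/-- The function `k ↦ ∫_G conj(φ(x)) φ(k x g) dg(x)`. Its integral over `H` is the value at `g` of a
matrix coefficient of `L²(H \ G)`. -/
def correlation (dg : Measure G) (φ : G → ℂ) (g k : G) : ℂ :=
  ∫ x, conj (φ x) * φ (k * x * g) ∂dg

variable [IsTopologicalGroup G]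

omit [MeasurableSpace G] in
theorem hasCompactSupport_mul_comp_coe_mul (hH : IsClosed (H : Set G)) {R : Type*} [MulZeroClass R]
    {φ ψ : G → R} (hφc : HasCompactSupport φ) (hψc : HasCompactSupport ψ) :
    HasCompactSupport fun p : G × H => φ p.1 * ψ (p.2 * p.1) := by
  refine HasCompactSupport.of_support_subset_isCompact (hφc.isCompact.prod
    (hH.isClosedEmbedding_subtypeVal.isCompact_preimage (hψc.isCompact.mul hφc.isCompact.inv))) ?_
  rintro ⟨x, h⟩ hne
  have hx : x ∈ tsupport φ := subset_tsupport _ (left_ne_zero_of_mul hne)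
  exact ⟨hx, h * x, subset_tsupport _ (right_ne_zero_of_mul hne), x⁻¹, Set.inv_mem_inv.2 hx,
    by simp⟩

variable [BorelSpace G]

section

variable [IsFiniteMeasureOnCompacts ν] [ν.IsMulLeftInvariant] [ν.IsInvInvariant]
  [IsFiniteMeasureOnCompacts dg] [dg.IsMulLeftInvariant]

theorem integral_cosetIntegral_mul_comm (hH : IsClosed (H : Set G)) {φ ψ : G → ℝ}
    (hφ : Continuous φ) (hφc : HasCompactSupport φ) (hψ : Continuous ψ)
    (hψc : HasCompactSupport ψ) :
    ∫ x, φ x * cosetIntegral ν ψ (RightCosets.mk H x) ∂dg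
      = ∫ x, cosetIntegral ν φ (RightCosets.mk H x) * ψ x ∂dg := by
  calc ∫ x, φ x * cosetIntegral ν ψ (RightCosets.mk H x) ∂dg
      = ∫ x, ∫ h : H, φ x * ψ (h * x) ∂ν ∂dg := by simp only [cosetIntegral_mk, integral_const_mul]
    _ = ∫ h : H, ∫ x, φ x * ψ (h * x) ∂dg ∂ν :=
        integral_integral_swap_of_hasCompactSupport (f := fun x (h : H) => φ x * ψ (h * x))
          (by fun_prop) (hasCompactSupport_mul_comp_coe_mul hH hφc hψc)
    _ = ∫ h : H, ∫ x, φ (h⁻¹ * x) * ψ x ∂dg ∂ν := by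
        congr! 2 with h
        simpa using integral_mul_left_eq_self (μ := dg) (fun x => φ (h⁻¹ * x) * ψ x) h
    _ = ∫ h : H, ∫ x, ψ x * φ (h * x) ∂dg ∂ν := by
        rw [← integral_inv_eq_self]
        simp [mul_comm]
    _ = ∫ x, ∫ h : H, ψ x * φ (h * x) ∂ν ∂dg :=
        (integral_integral_swap_of_hasCompactSupport (f := fun x (h : H) => ψ x * φ (h * x))
          (by fun_prop) (hasCompactSupport_mul_comp_coe_mul hH hψc hφc)).symm
    _ = ∫ x, cosetIntegral ν φ (RightCosets.mk H x) * ψ x ∂dg := by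
        simp only [cosetIntegral_mk, integral_const_mul, mul_comm]

variable [LocallyCompactSpace G] [ν.IsOpenPosMeasure]

theorem integral_eq_zero_of_cosetIntegral_eq_zero (hH : IsClosed (H : Set G)) {φ : G → ℝ}
    (hφ : Continuous φ) (hφc : HasCompactSupport φ) (h0 : cosetIntegral ν φ = 0) :
    ∫ x, φ x ∂dg = 0 := by
  obtain ⟨θ, hθ, hθc, -, hθ1⟩ := exists_cosetIntegral_eq_one (ν := ν) hH
    (hφc.isCompact.image RightCosets.continuous_mk)
  calc ∫ x, φ x ∂dg = ∫ x, cosetIntegral ν θ (RightCosets.mk H x) * φ x ∂dg := by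
        refine integral_congr_ae (Eventually.of_forall fun x => ?_)
        by_cases hx : x ∈ tsupport φ
        · simp [hθ1 _ (Set.mem_image_of_mem _ hx)]
        · simp [image_eq_zero_of_notMem_tsupport hx]
    _ = ∫ x, θ x * cosetIntegral ν φ (RightCosets.mk H x) ∂dg :=
        (integral_cosetIntegral_mul_comm hH hθ hθc hφ hφc).symm
    _ = 0 := by simp [h0]

theorem exists_weilFormula [T2Space G] (hH : IsClosed (H : Set G)) :
    ∃ μ : Measure (RightCosets H), μ.Regular ∧ WeilFormula ν dg μ := by
  have := RightCosets.t2Space hH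
  let P := cosetIntegralLinearMap hH ν
  let I : C_c(G, ℝ) →ₗ[ℝ] ℝ :=
    (CompactlySupportedContinuousMap.integralPositiveLinearMap dg).toLinearMap
  have hI : I ∈ P.ker.dualAnnihilator := (Submodule.mem_dualAnnihilator _).2 fun φ hφ =>
    integral_eq_zero_of_cosetIntegral_eq_zero (ν := ν) hH (map_continuous φ) φ.hasCompactSupport
      (congrArg DFunLike.coe hφ)
  rw [← LinearMap.range_dualMap_eq_dualAnnihilator_ker] at hI
  obtain ⟨Λ, hΛI⟩ := hI
  have hΛ_apply (φ : C_c(G, ℝ)) : Λ (P φ) = ∫ x, φ x ∂dg := DFunLike.congr_fun hΛI φ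
  have hΛ_nonneg (f) (hf : 0 ≤ f) : 0 ≤ Λ f := by
    obtain ⟨φ, rfl, hφ⟩ := exists_cosetIntegralLinearMap_eq (ν := ν) hH f
    exact (hΛ_apply φ).symm ▸ integral_nonneg (hφ hf)
  obtain ⟨μ, hμ, hμΛ⟩ := exists_regular_integral_eq Λ hΛ_nonneg
  exact ⟨μ, hμ, fun φ => (hμΛ (P φ)).trans (hΛ_apply φ)⟩

end

namespace WeilFormula

variable [LocallyCompactSpace G] [IsFiniteMeasureOnCompacts ν] [ν.IsMulRightInvariant]

theorem integral_cosetIntegral_eq [IsFiniteMeasureOnCompacts dg] [IsFiniteMeasureOnCompacts μ]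
    (hw : WeilFormula ν dg μ) (hH : IsClosed (H : Set G)) {E : Type*} [NormedAddCommGroup E]
    [NormedSpace ℝ E] [CompleteSpace E] {φ : G → E} (hφ : Continuous φ)
    (hφc : HasCompactSupport φ) : ∫ q, cosetIntegral ν φ q ∂μ = ∫ x, φ x ∂dg := by
  refine (SeparatingDual.eq_iff_forall_dual_eq (R := ℝ)).2 fun L => ?_
  have h_left : Integrable (cosetIntegral ν φ) μ :=
    (continuous_cosetIntegral hH hφ hφc).integrable_of_hasCompactSupport
      (hasCompactSupport_cosetIntegral hH hφc)
  have h_coset (q) : L (cosetIntegral ν φ q) = cosetIntegral ν (L ∘ φ) q :=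
    (L.integral_comp_comm ((by fun_prop : Continuous fun h : H => φ (h * q.out))
      |>.integrable_of_hasCompactSupport (hasCompactSupport_comp_coe_mul hH hφc _))).symm
  rw [← L.integral_comp_comm h_left,
    ← L.integral_comp_comm (hφ.integrable_of_hasCompactSupport hφc)]
  simp only [h_coset]
  exact hw ⟨⟨L ∘ φ, L.continuous.comp hφ⟩, hφc.comp_left L.map_zero⟩

theorem smulInvariantMeasure [T2Space G] [ν.IsOpenPosMeasure] [dg.IsMulRightInvariant] [μ.Regular]
    (hw : WeilFormula ν dg μ) (hH : IsClosed (H : Set G)) :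
    SMulInvariantMeasure Gᵐᵒᵖ (RightCosets H) μ := by
  have := RightCosets.t2Space hH
  refine ⟨fun g s hs => ?_⟩
  suffices h_map : μ.map (Homeomorph.smul g) = μ by
    conv_rhs => rw [← h_map]
    exact (Measure.map_apply (Homeomorph.smul g).measurable hs).symm
  refine map_homeomorph_eq_self_of_integral_comp_eq _ fun f => ?_
  obtain ⟨φ, rfl, -⟩ := exists_cosetIntegralLinearMap_eq (ν := ν) hH f
  let φg : C_c(G, ℝ) := ⟨⟨fun x => φ (x * g.unop), by fun_prop⟩,
    φ.hasCompactSupport.comp_homeomorph (Homeomorph.mulRight g.unop)⟩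
  calc ∫ q, cosetIntegral ν φ (g • q) ∂μ = ∫ q, cosetIntegral ν φg q ∂μ :=
        integral_congr_ae (.of_forall fun q => (cosetIntegral_comp_mul_right φ g.unop q).symm)
    _ = ∫ x, φ (x * g.unop) ∂dg := hw φg
    _ = ∫ x, φ x ∂dg := integral_mul_right_eq_self _ _
    _ = ∫ q, cosetIntegral ν φ q ∂μ := (hw φ).symm

omit [IsFiniteMeasureOnCompacts ν] [ν.IsMulRightInvariant] in
theorem ne_zero [dg.IsOpenPosMeasure] [IsFiniteMeasureOnCompacts dg]
    (hw : WeilFormula ν dg μ) : μ ≠ 0 := by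
  rintro rfl
  obtain ⟨φ, hφ1, -, hφc, hφ01⟩ := exists_continuous_one_zero_of_isCompact
    (isCompact_singleton (x := (1 : G))) isClosed_empty (Set.disjoint_empty _)
  refine (Continuous.integral_pos_of_hasCompactSupport_nonneg_nonzero (μ := dg) (x := 1)
    φ.continuous hφc (fun x => (hφ01 x).1) ?_).ne ?_
  · simp [hφ1 rfl]
  · simpa using hw ⟨φ, hφc⟩

theorem exists_smul_of_smulInvariantMeasure [T2Space G] [ν.IsOpenPosMeasure] [dg.IsHaarMeasure]
    [dg.IsMulRightInvariant] [dg.Regular] [μ.Regular] [SMulInvariantMeasure Gᵐᵒᵖ _ μ]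
    (hH : IsClosed (H : Set G)) (hμ : μ ≠ 0) :
    ∃ c : ℝ≥0, c ≠ 0 ∧ WeilFormula ν (c • dg) μ := by
  have := RightCosets.t2Space hH
  have := isInvInvariant_of_isMulRightInvariant dg
  obtain ⟨ρ, hρ, hρμ⟩ := exists_regular_integral_eq
    ((CompactlySupportedContinuousMap.integralPositiveLinearMap μ).toLinearMap ∘ₗ
      cosetIntegralLinearMap hH ν)
    fun φ hφ => integral_nonneg fun q => integral_nonneg fun h => hφ _
  have hw : WeilFormula ν ρ μ := fun φ => (hρμ φ).symm
  have : ρ.IsMulRightInvariant := by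
    refine ⟨fun g => map_homeomorph_eq_self_of_integral_comp_eq (Homeomorph.mulRight g) fun φ => ?_⟩
    let φg : C_c(G, ℝ) := ⟨⟨fun x => φ (x * g), by fun_prop⟩,
      φ.hasCompactSupport.comp_homeomorph (Homeomorph.mulRight g)⟩
    calc ∫ x, φg x ∂ρ = ∫ q, cosetIntegral ν φ (MulOpposite.op g • q) ∂μ :=
          (hw φg).symm.trans (integral_congr_ae (.of_forall (cosetIntegral_comp_mul_right φ g)))
      _ = ∫ q, cosetIntegral ν φ q ∂μ := integral_smul_eq_self _
      _ = ∫ x, φ x ∂ρ := hw φ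
  obtain ⟨c, rfl⟩ := exists_eq_smul_of_isMulRightInvariant ρ dg
  refine ⟨c, ?_, hw⟩
  rintro rfl
  refine hμ (Measure.ext_of_integral_eq_on_compactlySupported fun f => ?_)
  obtain ⟨φ, rfl, -⟩ := exists_cosetIntegralLinearMap_eq (ν := ν) hH f
  calc ∫ q, cosetIntegral ν φ q ∂μ = 0 := by simpa using hw φ
    _ = ∫ q, cosetIntegral ν φ q ∂0 := integral_zero_measure _ |>.symm

/-- With `F = cosetIntegral ν φ`, the product `conj F(q) * F(q g)` is the coset integral of
`conj φ(x) * F(H x g)`, to which Weil's formula applies. -/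
theorem integral_conj_mul_smul_eq [IsFiniteMeasureOnCompacts dg]
    [IsFiniteMeasureOnCompacts μ] (hw : WeilFormula ν dg μ) (hH : IsClosed (H : Set G)) {φ : G → ℂ}
    (hφ : Continuous φ) (hφc : HasCompactSupport φ) (g : G) :
    ∫ q, conj (cosetIntegral ν φ q) * cosetIntegral ν φ (MulOpposite.op g • q) ∂μ
      = ∫ h : H, correlation dg φ g h ∂ν := by
  let F := cosetIntegral ν φ
  have hF : Continuous F := continuous_cosetIntegral hH hφ hφc
  have hφc_conj : HasCompactSupport fun x => conj (φ x) := hφc.comp_left (map_zero conj)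
  have hφc_mul : HasCompactSupport fun x => φ (x * g) :=
    hφc.comp_homeomorph (Homeomorph.mulRight g)
  have h_conj (q) : conj (F q) = cosetIntegral ν (fun x => conj (φ x)) q := integral_conj.symm
  calc ∫ q, conj (F q) * F (MulOpposite.op g • q) ∂μ
      = ∫ q, cosetIntegral ν (fun x => conj (φ x) • F (RightCosets.mk H (x * g))) q ∂μ := by
        refine integral_congr_ae (.of_forall fun q => ?_)
        simp only [h_conj]
        exact (cosetIntegral_smul_comp_mk (fun x => conj (φ x))
          (fun q => F (MulOpposite.op g • q)) q).symm
    _ = ∫ x, conj (φ x) • F (RightCosets.mk H (x * g)) ∂dg :=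
        hw.integral_cosetIntegral_eq hH (by fun_prop) hφc_conj.smul_right
    _ = ∫ x, ∫ h : H, conj (φ x) * φ (h * x * g) ∂ν ∂dg := by
        simp only [F, cosetIntegral_mk, smul_eq_mul, integral_const_mul, mul_assoc]
    _ = ∫ h : H, ∫ x, conj (φ x) * φ (h * x * g) ∂dg ∂ν :=
        integral_integral_swap_of_hasCompactSupport
          (f := fun x (h : H) => conj (φ x) * φ (h * x * g)) (by fun_prop)
          (by
            simpa only [mul_assoc, Function.uncurry_def] using
              hasCompactSupport_mul_comp_coe_mul hH hφc_conj hφc_mul)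

end WeilFormula

end WeilIntegration

/-! ### Vague convergence -/

section VagueConvergence

open CompactlySupported NNReal UniformConvergence

variable {X : Type*} [TopologicalSpace X] [MeasurableSpace X] {ι : Type*} {m : ι → Measure X}
  {l : Filter ι} {μ : Measure X}

/-- Vague convergence of measures, i.e. convergence of the integrals of all compactly supported
continuous functions. -/
def VaguelyTendsto (m : ι → Measure X) (l : Filter ι) (μ : Measure X) : Prop :=
  ∀ f : C_c(X, ℝ), Tendsto (fun i => ∫ x, f x ∂m i) l (𝓝 (∫ x, f x ∂μ))

/-- A family of measures is bounded on compact sets if each compact set has uniformly bounded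
measure; this is the condition for vague relative compactness. -/
def BoundedOnCompacts (m : ι → Measure X) : Prop :=
  ∀ L : Set X, IsCompact L → ∃ C : ℝ≥0, ∀ i, m i L ≤ C

theorem BoundedOnCompacts.isFiniteMeasureOnCompacts (hm : BoundedOnCompacts m) (i : ι) :
    IsFiniteMeasureOnCompacts (m i) :=
  ⟨fun L hL => let ⟨_, hC⟩ := hm L hL; (hC i).trans_lt ENNReal.coe_lt_top⟩

omit [TopologicalSpace X] in
theorem norm_integral_le_mul_of_forall_notMem_eq_zero {E : Type*} [NormedAddCommGroup E]
    [NormedSpace ℝ E] {f : X → E} {L : Set X} {B : ℝ} {C : ℝ≥0} (hf : ∀ x ∉ L, f x = 0)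
    (hB : ∀ x ∈ L, ‖f x‖ ≤ B) (hB0 : 0 ≤ B) (hC : μ L ≤ C) : ‖∫ x, f x ∂μ‖ ≤ B * C := by
  rw [← setIntegral_eq_integral_of_forall_compl_eq_zero hf]
  refine (norm_setIntegral_le_of_norm_le_const (hC.trans_lt ENNReal.coe_lt_top) hB).trans ?_
  gcongr
  exact ENNReal.toReal_le_coe_of_le_coe hC

theorem BoundedOnCompacts.exists_tendsto_integral (hm : BoundedOnCompacts m) (U : Ultrafilter ι)
    (f : C_c(X, ℝ)) : ∃ a, Tendsto (fun i => ∫ x, f x ∂m i) U (𝓝 a) := by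
  obtain ⟨C, hC⟩ := hm _ f.hasCompactSupport.isCompact
  obtain ⟨B, hB⟩ := f.hasCompactSupport.exists_bound_of_continuous (map_continuous f)
  have h_mem (i) : ∫ x, f x ∂m i ∈ Metric.closedBall (0 : ℝ) (max B 0 * C) := by
    rw [mem_closedBall_zero_iff]
    exact norm_integral_le_mul_of_forall_notMem_eq_zero
      (fun x hx => image_eq_zero_of_notMem_tsupport hx)
      (fun x _ => (hB x).trans (le_max_left B 0)) (le_max_right B 0) (hC i)
  obtain ⟨a, -, ha⟩ := (isCompact_closedBall (0 : ℝ) (max B 0 * C)).ultrafilter_le_nhds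
    (U.map fun i => ∫ x, f x ∂m i) (le_principal_iff.2 (mem_map.2 (Eventually.of_forall h_mem)))
  exact ⟨a, ha⟩

variable [BorelSpace X]

theorem BoundedOnCompacts.exists_vaguelyTendsto [T2Space X] [LocallyCompactSpace X]
    (hm : BoundedOnCompacts m) (U : Ultrafilter ι) :
    ∃ μ : Measure X, μ.Regular ∧ VaguelyTendsto m U μ := by
  have := hm.isFiniteMeasureOnCompacts
  have h_int (f : C_c(X, ℝ)) i : Integrable f (m i) :=
    (map_continuous f).integrable_of_hasCompactSupport f.hasCompactSupport
  choose Λ hΛ using hm.exists_tendsto_integral U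
  let Λₗ : C_c(X, ℝ) →ₗ[ℝ] ℝ :=
    { toFun := Λ
      map_add' := fun f g => tendsto_nhds_unique (hΛ (f + g)) <|
        ((hΛ f).add (hΛ g)).congr fun i => (integral_add (h_int f i) (h_int g i)).symm
      map_smul' := fun c f => tendsto_nhds_unique (hΛ (c • f)) <|
        ((hΛ f).const_smul c).congr fun i => (integral_smul c f).symm }
  obtain ⟨μ, hμ, hμΛ⟩ := exists_regular_integral_eq Λₗ fun f hf =>
    ge_of_tendsto' (hΛ f) fun i => integral_nonneg hf
  exact ⟨μ, hμ, fun f => (hμΛ f).symm ▸ hΛ f⟩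

theorem VaguelyTendsto.tendsto_integral_complex (hμ : VaguelyTendsto m l μ)
    (hm : ∀ i, IsFiniteMeasureOnCompacts (m i)) [IsFiniteMeasureOnCompacts μ] {f : X → ℂ}
    (hf : Continuous f) (hfc : HasCompactSupport f) :
    Tendsto (fun i => ∫ x, f x ∂m i) l (𝓝 (∫ x, f x ∂μ)) := by
  have h_split (ρ : Measure X) [IsFiniteMeasureOnCompacts ρ] :
      ((∫ x, (f x).re ∂ρ : ℝ) : ℂ) + (∫ x, (f x).im ∂ρ : ℝ) * Complex.I = ∫ x, f x ∂ρ :=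
    integral_re_add_im (hf.integrable_of_hasCompactSupport hfc)
  have h_re := hμ ⟨⟨_, Complex.continuous_re.comp hf⟩, hfc.comp_left Complex.zero_re⟩
  have h_im := hμ ⟨⟨_, Complex.continuous_im.comp hf⟩, hfc.comp_left Complex.zero_im⟩
  rw [← h_split μ]
  exact (h_re.ofReal.add (h_im.ofReal.mul_const Complex.I)).congr fun i => h_split (m i)

theorem VaguelyTendsto.ne_zero [T2Space X] [LocallyCompactSpace X] [l.NeBot]
    (hμ : VaguelyTendsto m l μ) (hm : ∀ i, IsFiniteMeasureOnCompacts (m i)) {K : Set X}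
    (hK : IsCompact K) (hmK : ∀ i, m i K = 1) : μ ≠ 0 := by
  rintro rfl
  obtain ⟨f, hfK, -, hfc, hf01⟩ :=
    exists_continuous_one_zero_of_isCompact hK isClosed_empty (Set.disjoint_empty K)
  have h_one_le (i) : 1 ≤ ∫ x, f x ∂m i := by
    calc (1 : ℝ) = ∫ x in K, f x ∂m i := by
          simp [setIntegral_congr_fun hK.measurableSet hfK, Measure.real, hmK i]
      _ ≤ ∫ x, f x ∂m i := setIntegral_le_integral
          (f.continuous.integrable_of_hasCompactSupport hfc) (.of_forall fun x => (hf01 x).1)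
  have h_lim := ge_of_tendsto' (hμ ⟨f, hfc⟩) h_one_le
  rw [integral_zero_measure] at h_lim
  exact absurd h_lim (by norm_num)

theorem BoundedOnCompacts.equicontinuous_integral [R1Space X] (hm : BoundedOnCompacts m)
    {Y E : Type*} [TopologicalSpace Y] [NormedAddCommGroup E] [NormedSpace ℝ E] {F : Y → X → E}
    (hF : Continuous F.uncurry)
    (hFc : ∀ y₀, ∃ L : Set X, IsCompact L ∧ ∀ᶠ y in 𝓝 y₀, ∀ x ∉ L, F y x = 0) :
    Equicontinuous fun i y => ∫ x, F y x ∂m i := by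
  have := hm.isFiniteMeasureOnCompacts
  intro y₀
  obtain ⟨L, hL, hFL⟩ := hFc y₀
  obtain ⟨C, hC⟩ := hm L hL
  have hF_apply (y) : Continuous (F y) := hF.comp (by fun_prop : Continuous fun x => (y, x))
  have h_int {y} (hy : ∀ x ∉ L, F y x = 0) i : Integrable (F y) (m i) :=
    (hF_apply y).integrable_of_hasCompactSupport (.intro hL hy)
  refine Metric.equicontinuousAt_iff_right.2 fun ε hε => ?_
  have hδ : 0 < ε / (C + 1) := by positivity
  have h_near : ∀ᶠ y in 𝓝 y₀, ∀ x ∈ L, ‖F y₀ x - F y x‖ < ε / (C + 1) := by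
    refine hL.eventually_forall_of_forall_eventually fun x _ => ?_
    have h_cont : Continuous fun z : Y × X => ‖F y₀ z.2 - F z.1 z.2‖ :=
      (((hF_apply y₀).comp continuous_snd).sub hF).norm
    exact h_cont.continuousAt.eventually (gt_mem_nhds (by simpa using hδ))
  filter_upwards [h_near, hFL] with y hy hyL i
  have hy₀L := hFL.self_of_nhds
  rw [dist_eq_norm, ← integral_sub (h_int hy₀L i) (h_int hyL i)]
  calc ‖∫ x, F y₀ x - F y x ∂m i‖ ≤ ε / (C + 1) * C :=
        norm_integral_le_mul_of_forall_notMem_eq_zero (fun x hx => by simp [hyL x hx, hy₀L x hx])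
          (fun x hx => (hy x hx).le) hδ.le (hC i)
    _ < ε := by
        rw [div_mul_eq_mul_div, div_lt_iff₀ (by positivity)]
        nlinarith

theorem VaguelyTendsto.tendstoUniformlyOn_integral [R1Space X] (hμ : VaguelyTendsto m l μ)
    (hm : BoundedOnCompacts m) [IsFiniteMeasureOnCompacts μ] {Y : Type*} [TopologicalSpace Y]
    {F : Y → X → ℂ} (hF : Continuous F.uncurry)
    (hFc : ∀ y₀, ∃ L : Set X, IsCompact L ∧ ∀ᶠ y in 𝓝 y₀, ∀ x ∉ L, F y x = 0) {Q : Set Y}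
    (hQ : IsCompact Q) :
    TendstoUniformlyOn (fun i y => ∫ x, F y x ∂m i) (fun y => ∫ x, F y x ∂μ) l Q := by
  have h_pointwise (y) : Tendsto (fun i => ∫ x, F y x ∂m i) l (𝓝 (∫ x, F y x ∂μ)) := by
    obtain ⟨L, hL, hFL⟩ := hFc y
    exact hμ.tendsto_integral_complex hm.isFiniteMeasureOnCompacts
      (hF.comp (by fun_prop : Continuous fun x => (y, x))) (.intro hL hFL.self_of_nhds)
  have h_ascoli := EquicontinuousOn.tendsto_uniformOnFun_iff_pi (𝔖 := {Q : Set Y | IsCompact Q})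
    (fun _ hK => hK) (Set.eq_univ_of_forall fun y => ⟨{y}, isCompact_singleton, rfl⟩)
    (fun K _ => (hm.equicontinuous_integral hF hFc).equicontinuousOn K) l
    (fun y => ∫ x, F y x ∂μ)
  exact UniformOnFun.tendsto_iff_tendstoUniformlyOn.1
    (h_ascoli.2 (tendsto_pi_nhds.2 h_pointwise)) Q hQ

end VagueConvergence

/-! ### Haar measures along a Chabauty limit -/

section ChabautyHaar

open CompactlySupported NNReal Pointwise

variable {G : Type*} [Group G] [TopologicalSpace G] [IsTopologicalGroup G] [MeasurableSpace G]
  [BorelSpace G]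

omit [IsTopologicalGroup G] in
theorem measurableEmbedding_coe {Γ : Subgroup G} (hΓ : IsClosed (Γ : Set G)) :
    MeasurableEmbedding ((↑) : Γ → G) :=
  hΓ.isClosedEmbedding_subtypeVal.measurableEmbedding

omit [IsTopologicalGroup G] in
theorem isFiniteMeasureOnCompacts_map_coe {Γ : Subgroup G} (hΓ : IsClosed (Γ : Set G))
    (ν : Measure Γ) [IsFiniteMeasureOnCompacts ν] :
    IsFiniteMeasureOnCompacts (ν.map ((↑) : Γ → G)) :=
  ⟨fun K hK => by
    rw [(measurableEmbedding_coe hΓ).map_apply]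
    exact (hΓ.isClosedEmbedding_subtypeVal.isCompact_preimage hK).measure_lt_top⟩

theorem map_mul_left_map_coe {Γ : Subgroup G} (ν : Measure Γ) [ν.IsMulLeftInvariant] (γ : Γ) :
    (ν.map ((↑) : Γ → G)).map ((γ : G) * ·) = ν.map (↑) := by
  have h_comp : ((γ : G) * ·) ∘ ((↑) : Γ → G) = (↑) ∘ (γ * ·) := rfl
  rw [Measure.map_map (measurable_const_mul _) measurable_subtype_coe, h_comp,
    ← Measure.map_map measurable_subtype_coe (measurable_const_mul γ), map_mul_left_eq_self]

theorem map_inv_map_coe {Γ : Subgroup G} (ν : Measure Γ) [ν.IsInvInvariant] :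
    (ν.map ((↑) : Γ → G)).map Inv.inv = ν.map (↑) := by
  have h_comp : Inv.inv ∘ ((↑) : Γ → G) = (↑) ∘ Inv.inv := rfl
  rw [Measure.map_map measurable_inv measurable_subtype_coe, h_comp,
    ← Measure.map_map measurable_subtype_coe measurable_inv, Measure.map_inv_eq_self]

theorem measure_preimage_coe_smul_le {Γ : Subgroup G} (ν : Measure Γ) [ν.IsMulLeftInvariant]
    (x : G) (K : Set G) :
    ν (((↑) : Γ → G) ⁻¹' (x • K)) ≤ ν (((↑) : Γ → G) ⁻¹' (K⁻¹ * K)) := by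
  obtain h_empty | ⟨γ₀, hγ₀⟩ := (((↑) : Γ → G) ⁻¹' (x • K)).eq_empty_or_nonempty
  · simp [h_empty]
  rw [← measure_preimage_mul ν γ₀⁻¹ (((↑) : Γ → G) ⁻¹' (K⁻¹ * K))]
  refine measure_mono fun γ hγ => ?_
  rw [Set.mem_preimage, Set.mem_smul_set_iff_inv_smul_mem, smul_eq_mul] at hγ₀ hγ
  exact ⟨_, Set.inv_mem_inv.2 hγ₀, _, hγ, by simp [mul_assoc]⟩

theorem boundedOnCompacts_map_coe {ι : Type*} {Γ : ι → Subgroup G}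
    (hΓ : ∀ i, IsClosed (Γ i : Set G)) (ν : ∀ i, Measure (Γ i)) [∀ i, (ν i).IsMulLeftInvariant]
    {V : Set G} (hV : V ∈ 𝓝 1) {C : ℝ≥0} (hνV : ∀ i, ν i ((↑) ⁻¹' V) ≤ C) :
    BoundedOnCompacts fun i => (ν i).map ((↑) : Γ i → G) := by
  obtain ⟨W, hW, hWV⟩ := exists_nhds_split_inv hV
  have h_sub : W⁻¹⁻¹ * W⁻¹ ⊆ V := by
    rintro _ ⟨a, ha, b, hb, rfl⟩
    simpa using hWV a (by simpa using ha) b⁻¹ (by simpa using hb)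
  intro L hL
  refine hL.induction_on (p := fun L => ∃ C : ℝ≥0, ∀ i, (ν i).map ((↑) : Γ i → G) L ≤ C)
    ⟨0, by simp⟩ (fun s t hst ⟨C, hC⟩ => ⟨C, fun i => (measure_mono hst).trans (hC i)⟩)
    (fun s t ⟨C, hC⟩ ⟨D, hD⟩ => ⟨C + D, fun i => ?_⟩) fun x _ => ⟨x • W⁻¹, ?_, C, fun i => ?_⟩
  · rw [ENNReal.coe_add]
    exact (measure_union_le s t).trans (add_le_add (hC i) (hD i))
  · exact mem_nhdsWithin_of_mem_nhds (by simpa using smul_mem_nhds_smul x (inv_mem_nhds_one G hW))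
  · rw [(measurableEmbedding_coe (hΓ i)).map_apply]
    exact (measure_preimage_coe_smul_le (ν i) x W⁻¹).trans
      ((measure_mono (Set.preimage_mono h_sub)).trans (hνV i))

theorem exists_isInvInvariant_preimage_coe_eq_one [LocallyCompactSpace G] {Γ : Subgroup G}
    (hΓ : IsClosed (Γ : Set G)) (h : IsUnimodularSubgroup Γ) {V : Set G} (hVc : IsCompact V)
    (hV : V ∈ 𝓝 1) :
    ∃ ν : Measure Γ, ν.IsHaarMeasure ∧ ν.IsInvInvariant ∧ ν ((↑) ⁻¹' V) = 1 := by
  obtain ⟨ν, _, _⟩ := (isUnimodularSubgroup_iff_exists_isInvInvariant hΓ).1 h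
  have h_top : ν (((↑) : Γ → G) ⁻¹' V) ≠ ∞ :=
    (hΓ.isClosedEmbedding_subtypeVal.isCompact_preimage hVc).measure_lt_top.ne
  have h_nhds : ((↑) : Γ → G) ⁻¹' V ∈ 𝓝 1 :=
    preimage_coe_mem_nhds_subtype.2 (mem_nhdsWithin_of_mem_nhds hV)
  have h_zero : ν (((↑) : Γ → G) ⁻¹' V) ≠ 0 := (Measure.measure_pos_of_mem_nhds ν h_nhds).ne'
  refine ⟨(ν ((↑) ⁻¹' V))⁻¹ • ν,
    .smul ν (ENNReal.inv_ne_zero.2 h_top) (ENNReal.inv_ne_top.2 h_zero), ⟨?_⟩,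
    ENNReal.inv_mul_cancel h_zero h_top⟩
  rw [Measure.inv, Measure.map_smul, ← Measure.inv, Measure.inv_eq_self]

section VagueLimit

variable [T2Space G] [LocallyCompactSpace G] {ι : Type*} {m : ι → Measure G} {l : Filter ι}
  [l.NeBot] {μ : Measure G} [μ.Regular]

theorem VaguelyTendsto.map_mul_left_eq_self (hμ : VaguelyTendsto m l μ) (hm : BoundedOnCompacts m)
    {γ : ι → G} {h : G} (hγ : Tendsto γ l (𝓝 h)) (hmγ : ∀ i, (m i).map (γ i * ·) = m i) :
    μ.map (h * ·) = μ := by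
  refine map_homeomorph_eq_self_of_integral_comp_eq (Homeomorph.mulLeft h) fun f => ?_
  have h_equi : Equicontinuous fun i g => ∫ k, f (g * k) ∂m i := by
    refine hm.equicontinuous_integral (by fun_prop) fun g₀ => ?_
    obtain ⟨P, hP, hPg₀⟩ := exists_compact_mem_nhds g₀
    refine ⟨P⁻¹ * tsupport f, hP.inv.mul f.hasCompactSupport.isCompact, ?_⟩
    filter_upwards [hPg₀] with g hg k hk
    by_contra h_ne
    exact hk ⟨g⁻¹, Set.inv_mem_inv.2 hg, g * k, subset_tsupport _ h_ne, by simp⟩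
  have h_inv (i) : ∫ k, f (γ i * k) ∂m i = ∫ k, f k ∂m i := by
    conv_rhs => rw [← hmγ i, integral_map (measurable_const_mul _).aemeasurable
      (map_continuous f).aestronglyMeasurable]
  refine tendsto_nhds_unique (hμ ⟨⟨_, (map_continuous f).comp (continuous_const_mul h)⟩,
    f.hasCompactSupport.comp_homeomorph (Homeomorph.mulLeft h)⟩) ((hμ f).congr_dist ?_)
  refine Metric.tendsto_nhds.2 fun ε hε => ?_
  filter_upwards [hγ.eventually (Metric.equicontinuousAt_iff_right.1 (h_equi h) ε hε)] with i hi
  have hi := hi i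
  rw [h_inv, dist_comm] at hi
  rwa [Real.dist_0_eq_abs, abs_dist]

theorem VaguelyTendsto.map_inv_eq_self (hμ : VaguelyTendsto m l μ)
    (hm : ∀ i, (m i).map Inv.inv = m i) : μ.map Inv.inv = μ := by
  refine map_homeomorph_eq_self_of_integral_comp_eq (Homeomorph.inv G) fun f => ?_
  refine tendsto_nhds_unique (hμ ⟨⟨_, (map_continuous f).comp continuous_inv⟩,
    f.hasCompactSupport.comp_homeomorph (Homeomorph.inv G)⟩) ((hμ f).congr fun i => ?_)
  conv_lhs => rw [← hm i, integral_map measurable_inv.aemeasurable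
    (map_continuous f).aestronglyMeasurable]
  rfl

end VagueLimit

theorem exists_isHaarMeasure_map_coe_eq {H : Subgroup G} (hH : IsClosed (H : Set G))
    {μ : Measure G} [μ.Regular] (hμ0 : μ ≠ 0) (hμH : μ (H : Set G)ᶜ = 0)
    (h_left : ∀ h ∈ H, μ.map (h * ·) = μ) (h_inv : μ.map Inv.inv = μ) :
    ∃ ν : Measure H, ν.IsHaarMeasure ∧ ν.IsInvInvariant ∧ ν.map (↑) = μ := by
  have h_emb := measurableEmbedding_coe hH
  let ν : Measure H := μ.comap (↑)
  have hν_map : ν.map (↑) = μ := by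
    rw [h_emb.map_comap, Subtype.range_coe]
    exact Measure.restrict_eq_self_of_ae_mem (mem_ae_iff.2 hμH)
  have eq_of_map_coe_eq {ρ : Measure H} (h : ρ.map (↑) = μ) : ρ = ν := by
    rw [← h_emb.comap_map ρ, h]
  have : ν.IsMulLeftInvariant := by
    refine ⟨fun h => eq_of_map_coe_eq ?_⟩
    rw [Measure.map_map measurable_subtype_coe (measurable_const_mul h)]
    change ν.map (((h : G) * ·) ∘ (↑)) = μ
    rw [← Measure.map_map (measurable_const_mul _) measurable_subtype_coe, hν_map, h_left h h.2]
  have : ν.IsInvInvariant := by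
    refine ⟨eq_of_map_coe_eq ?_⟩
    rw [Measure.inv, Measure.map_map measurable_subtype_coe measurable_inv]
    change ν.map (Inv.inv ∘ (↑)) = μ
    rw [← Measure.map_map measurable_inv measurable_subtype_coe, hν_map, h_inv]
  have : IsFiniteMeasureOnCompacts ν :=
    .comap' μ continuous_subtype_val h_emb
  obtain ⟨K, hK, hμK⟩ := Measure.Regular.exists_isCompact_not_null.2 hμ0
  have : ν.IsOpenPosMeasure := by
    refine isOpenPosMeasure_of_mulLeftInvariant_of_compact ((↑) ⁻¹' K)
      (hH.isClosedEmbedding_subtypeVal.isCompact_preimage hK) ?_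
    rwa [← h_emb.map_apply, hν_map]
  exact ⟨ν, {}, inferInstance, hν_map⟩

namespace ChabautyTendsto

variable {Γ : ℕ → Subgroup G} {H : Subgroup G}

omit [IsTopologicalGroup G] [MeasurableSpace G] [BorelSpace G] in
theorem eventually_disjoint (hlim : ChabautyTendsto Γ H) {K : Set G} (hK : IsCompact K)
    (hKH : Disjoint K H) : ∀ᶠ n in atTop, Disjoint K (Γ n) := by
  by_contra h_frequently
  have h_pick (n) : ∃ g ∈ Γ n, ¬Disjoint K (Γ n) → g ∈ K := by
    by_cases h : Disjoint K (Γ n)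
    · exact ⟨1, one_mem _, fun h' => absurd h h'⟩
    · obtain ⟨g, hgK, hgΓ⟩ := Set.not_disjoint_iff.1 h
      exact ⟨g, hgΓ, fun _ => hgK⟩
  choose g hgΓ hgK using h_pick
  obtain ⟨x, hxK, hx⟩ := hK.exists_mapClusterPt_of_frequently
    ((not_eventually.1 h_frequently).mono hgK)
  exact hKH.notMem_of_mem_left hxK (hlim.2 g hgΓ x hx)

variable [LocallyCompactSpace G]

theorem measure_compl_eq_zero {l : Filter ℕ} [l.NeBot] (hlim : ChabautyTendsto Γ H) (hl : l ≤ atTop)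
    (hH : IsClosed (H : Set G)) {ν : ∀ n, Measure (Γ n)} {μ : Measure G} [μ.Regular]
    (hμ : VaguelyTendsto (fun n => (ν n).map ((↑) : Γ n → G)) l μ) : μ (H : Set G)ᶜ = 0 := by
  rw [hH.isOpen_compl.measure_eq_iSup_isCompact]
  simp only [ENNReal.iSup_eq_zero]
  intro K hKH hK
  obtain ⟨K', hK', hKK', hK'H⟩ := exists_compact_between hK hH.isOpen_compl hKH
  obtain ⟨f, hfK, hfK', hfc, hf01⟩ := exists_continuous_one_zero_of_isCompact hK
    isOpen_interior.isClosed_compl (Set.disjoint_compl_right_iff_subset.2 hKK')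
  have h_lim : Tendsto (fun _ => 0) l (𝓝 (∫ k, f k ∂μ)) := by
    refine (hμ ⟨f, hfc⟩).congr' ?_
    filter_upwards [hl (hlim.eventually_disjoint hK' (Set.subset_compl_iff_disjoint_right.1 hK'H))]
      with n hn
    change ∫ k, f k ∂(ν n).map ((↑) : Γ n → G) = 0
    rw [integral_map measurable_subtype_coe.aemeasurable f.continuous.aestronglyMeasurable]
    exact integral_eq_zero_of_ae <| .of_forall fun γ =>
      hfK' fun hγ => hn.notMem_of_mem_right γ.2 (interior_subset hγ)
  have h_ae := (integral_eq_zero_iff_of_nonneg (fun k => (hf01 k).1)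
    (f.continuous.integrable_of_hasCompactSupport hfc)).1
    (tendsto_nhds_unique h_lim tendsto_const_nhds)
  exact measure_mono_null (fun k hk => by simp [hfK hk]) (ae_iff.1 h_ae)

theorem exists_isHaarMeasure_vaguelyTendsto [T2Space G] (hlim : ChabautyTendsto Γ H)
    {U : Ultrafilter ℕ}
    (hU : U ≤ (atTop : Filter ℕ)) (hΓ : ∀ n, IsClosed (Γ n : Set G)) (hH : IsClosed (H : Set G))
    (ν : ∀ n, Measure (Γ n)) [∀ n, (ν n).IsMulLeftInvariant] [∀ n, (ν n).IsInvInvariant]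
    {V : Set G} (hVc : IsCompact V) (hV : V ∈ 𝓝 1) (hνV : ∀ n, ν n ((↑) ⁻¹' V) = 1) :
    ∃ ν' : Measure H, ν'.IsHaarMeasure ∧ ν'.IsInvInvariant ∧
      VaguelyTendsto (fun n => (ν n).map ((↑) : Γ n → G)) U (ν'.map (↑)) := by
  have hm := boundedOnCompacts_map_coe hΓ ν hV (C := 1) fun n => (hνV n).le
  obtain ⟨μ, _, hμ⟩ := hm.exists_vaguelyTendsto U
  have hmV (n) : (ν n).map ((↑) : Γ n → G) V = 1 := by
    rw [(measurableEmbedding_coe (hΓ n)).map_apply, hνV]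
  have h_left (h : G) (hh : h ∈ H) : μ.map (h * ·) = μ := by
    obtain ⟨γ, hγΓ, hγ⟩ := hlim.1 h hh
    exact hμ.map_mul_left_eq_self hm (hγ.mono_left hU) fun n =>
      map_mul_left_map_coe (ν n) ⟨γ n, hγΓ n⟩
  obtain ⟨ν', hν', hν'_inv, rfl⟩ := exists_isHaarMeasure_map_coe_eq hH
    (hμ.ne_zero hm.isFiniteMeasureOnCompacts hVc hmV) (hlim.measure_compl_eq_zero hU hH hμ) h_left
    (hμ.map_inv_eq_self fun n => map_inv_map_coe (ν n))
  exact ⟨ν', hν', hν'_inv, hμ⟩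

end ChabautyTendsto

end ChabautyHaar

/-! ### Weak containment -/

section WeakContainment

open ComplexConjugate NNReal

namespace UnitaryRep

variable {G : Type*} [Group G] [TopologicalSpace G] {V W : Type*} [NormedAddCommGroup V]
  [InnerProductSpace ℂ V] [NormedAddCommGroup W] [InnerProductSpace ℂ W]

/-- The functions on `G` that are limits, uniformly on compact sets, of convex combinations of
diagonal matrix coefficients of `σ`. -/
def weakClosure (σ : UnitaryRep G W) : Set (G → ℂ) :=
  {f | ∀ Q : Set G, IsCompact Q → ∀ ε > 0,
    ∃ φ ∈ convexHull ℝ (Set.range σ.diagCoeff), ∀ g ∈ Q, ‖f g - φ g‖ < ε}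

theorem weaklyContainedIn_iff_forall_mem_weakClosure {π : UnitaryRep G V} {σ : UnitaryRep G W} :
    π.WeaklyContainedIn σ ↔ ∀ v, π.diagCoeff v ∈ σ.weakClosure :=
  Iff.rfl

theorem mem_weakClosure_of_tendstoUniformlyOn {σ : UnitaryRep G W} {ι : Type*} {l : Filter ι}
    [l.NeBot] {F : ι → G → ℂ} {f : G → ℂ} (hF : ∀ᶠ i in l, F i ∈ σ.weakClosure)
    (hf : ∀ Q, IsCompact Q → TendstoUniformlyOn F f l Q) : f ∈ σ.weakClosure := by
  intro Q hQ ε hε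
  obtain ⟨i, hi_mem, hi⟩ :=
    (hF.and (Metric.tendstoUniformlyOn_iff.1 (hf Q hQ) (ε / 2) (half_pos hε))).exists
  obtain ⟨φ, hφ, hφi⟩ := hi_mem Q hQ (ε / 2) (half_pos hε)
  refine ⟨φ, hφ, fun g hg => ?_⟩
  calc ‖f g - φ g‖ ≤ ‖f g - F i g‖ + ‖F i g - φ g‖ := norm_sub_le_norm_sub_add_norm_sub _ _ _
    _ < ε / 2 + ε / 2 := add_lt_add (by simpa [dist_eq_norm] using hi g hg) (hφi g hg)
    _ = ε := add_halves ε

theorem norm_diagCoeff_sub_le (π : UnitaryRep G V) (v w : V) (g : G) :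
    ‖π.diagCoeff v g - π.diagCoeff w g‖ ≤ ‖v - w‖ * (‖v‖ + ‖w‖) := by
  calc ‖π.diagCoeff v g - π.diagCoeff w g‖
      = ‖inner ℂ (v - w) (π.toHom g v) + inner ℂ w (π.toHom g (v - w))‖ := by
        simp only [diagCoeff, map_sub, inner_sub_left, inner_sub_right, sub_add_sub_cancel]
    _ ≤ ‖v - w‖ * ‖v‖ + ‖w‖ * ‖v - w‖ := by
        refine (norm_add_le _ _).trans (add_le_add ?_ ?_)
        · simpa only [LinearIsometryEquiv.norm_map] using norm_inner_le_norm (v - w) (π.toHom g v)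
        · simpa only [LinearIsometryEquiv.norm_map] using norm_inner_le_norm w (π.toHom g (v - w))
    _ = ‖v - w‖ * (‖v‖ + ‖w‖) := by ring

theorem tendstoUniformly_diagCoeff (π : UnitaryRep G V) (v : V) :
    TendstoUniformly π.diagCoeff (π.diagCoeff v) (𝓝 v) := by
  have h_lim : Tendsto (fun w => ‖v - w‖ * (‖v‖ + ‖w‖)) (𝓝 v) (𝓝 0) := by
    have h_cont : Continuous fun w => ‖v - w‖ * (‖v‖ + ‖w‖) := by fun_prop
    simpa using h_cont.tendsto v
  refine Metric.tendstoUniformly_iff.2 fun ε hε => ?_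
  filter_upwards [h_lim.eventually_lt_const hε] with w hw g
  exact (dist_eq_norm (π.diagCoeff v g) _).trans_lt ((π.norm_diagCoeff_sub_le v w g).trans_lt hw)

theorem weaklyContainedIn_of_dense {π : UnitaryRep G V} {σ : UnitaryRep G W} {S : Set V}
    (hS : Dense S) (h : ∀ v ∈ S, π.diagCoeff v ∈ σ.weakClosure) : π.WeaklyContainedIn σ := by
  refine weaklyContainedIn_iff_forall_mem_weakClosure.2 fun v => ?_
  have := mem_closure_iff_nhdsWithin_neBot.1 (hS v)
  refine mem_weakClosure_of_tendstoUniformlyOn (l := 𝓝[S] v) (F := π.diagCoeff)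
    (eventually_mem_nhdsWithin.mono h) fun Q _ U hU => ?_
  exact nhdsWithin_le_nhds (((π.tendstoUniformly_diagCoeff v) U hU).mono fun _ hw g _ => hw g)

theorem smul_mem_range_diagCoeff (π : UnitaryRep G V) (c : ℝ≥0) {f : G → ℂ}
    (hf : f ∈ Set.range π.diagCoeff) : c • f ∈ Set.range π.diagCoeff := by
  obtain ⟨v, rfl⟩ := hf
  refine ⟨((NNReal.sqrt c : ℝ) : ℂ) • v, funext fun g => ?_⟩
  have h_sqrt : ((NNReal.sqrt c : ℝ) : ℂ) * (NNReal.sqrt c : ℝ) = (c : ℝ) := by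
    exact_mod_cast congrArg NNReal.toReal (NNReal.mul_self_sqrt c)
  rw [diagCoeff, map_smul, inner_smul_left, inner_smul_right, Complex.conj_ofReal, ← mul_assoc,
    h_sqrt]
  rfl

end UnitaryRep

section RightTranslation

variable {G : Type*} [Group G] [TopologicalSpace G] {X : Type*} [TopologicalSpace X] [R1Space X]
  [MeasurableSpace X] [BorelSpace X] [MulAction Gᵐᵒᵖ X] [ContinuousSMul Gᵐᵒᵖ X]

theorem diagCoeff_rightTranslationRep_toLp (μ : Measure X) [μ.Regular] [IsLocallyFiniteMeasure μ]
    [SMulInvariantMeasure Gᵐᵒᵖ X μ] {f : X → ℂ} (hf : MemLp f 2 μ) (g : G) :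
    (rightTranslationRep μ).diagCoeff (hf.toLp f) g
      = ∫ x, conj (f x) * f (MulOpposite.op g • x) ∂μ := by
  rw [UnitaryRep.diagCoeff, L2.inner_def]
  refine integral_congr_ae ?_
  filter_upwards [rightTranslationRep_ae_eq μ g (hf.toLp f), hf.coeFn_toLp,
    (measurePreserving_smul (MulOpposite.op g) μ).quasiMeasurePreserving.ae_eq_comp hf.coeFn_toLp]
    with x h_rep hx hgx
  simp only [Function.comp_apply] at hgx
  rw [h_rep, hx, hgx, RCLike.inner_apply, mul_comm]

theorem range_diagCoeff_rightTranslationRep_subset_of_eq_smul {μ ν : Measure X} [μ.Regular]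
    [IsLocallyFiniteMeasure μ] [SMulInvariantMeasure Gᵐᵒᵖ X μ] [ν.Regular]
    [IsLocallyFiniteMeasure ν] [SMulInvariantMeasure Gᵐᵒᵖ X ν] {c : ℝ≥0} (hc : c ≠ 0)
    (h : ν = c • μ) :
    Set.range (rightTranslationRep (G := G) μ).diagCoeff
      ⊆ Set.range (rightTranslationRep (G := G) ν).diagCoeff := by
  rintro _ ⟨v, rfl⟩
  have hv : MemLp v 2 ν := h ▸ (Lp.memLp v).smul_measure ENNReal.coe_ne_top
  have h_coeff : (rightTranslationRep μ).diagCoeff v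
      = c⁻¹ • (rightTranslationRep (G := G) ν).diagCoeff (hv.toLp v) := by
    funext g
    rw [Pi.smul_apply, diagCoeff_rightTranslationRep_toLp, h, integral_smul_nnreal_measure,
      inv_smul_smul₀ hc, ← diagCoeff_rightTranslationRep_toLp μ (Lp.memLp v), Lp.toLp_coeFn]
  exact h_coeff ▸ UnitaryRep.smul_mem_range_diagCoeff _ _ (Set.mem_range_self _)

theorem UnitaryRep.isTempered_iff_weaklyContainedIn [IsTopologicalGroup G] [LocallyCompactSpace G]
    [MeasurableSpace G] [BorelSpace G] (dg : Measure G) [dg.IsHaarMeasure]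
    [dg.IsMulRightInvariant] [dg.Regular] {V : Type*} [NormedAddCommGroup V]
    [InnerProductSpace ℂ V] {π : UnitaryRep G V} :
    π.IsTempered ↔ π.WeaklyContainedIn (rightTranslationRep (G := G) dg) := by
  refine ⟨?_, fun h => ⟨dg, ‹_›, ‹_›, ‹_›, inferInstance, h⟩⟩
  rintro ⟨dg', _, _, _, _, h⟩ v Q hQ ε hε
  obtain ⟨φ, hφ, hφε⟩ := h v Q hQ ε hε
  exact ⟨φ, convexHull_mono (range_diagCoeff_rightTranslationRep_subset_of_eq_smul
    (Measure.haarScalarFactor_pos_of_isHaarMeasure dg dg').ne'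
    (Measure.isMulLeftInvariant_eq_smul_of_regular dg dg')) hφ, hφε⟩

end RightTranslation

section LpDensity

variable {X : Type*} [TopologicalSpace X] [R1Space X] [WeaklyLocallyCompactSpace X]
  [MeasurableSpace X] [BorelSpace X] {E : Type*} [NormedAddCommGroup E] [NormedSpace ℝ E]
  {μ : Measure X} [μ.Regular] {p : ℝ≥0∞}

theorem exists_hasCompactSupport_eLpNorm_sub_indicator_le (hp : p ≠ ∞) (c : E) {s : Set X}
    (hs : MeasurableSet s) (hμs : μ s ≠ ∞) {ε : ℝ≥0∞} (hε : ε ≠ 0) :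
    ∃ f : X → E, eLpNorm (f - s.indicator fun _ => c) p μ ≤ ε ∧ Continuous f ∧
      HasCompactSupport f := by
  obtain ⟨η, hη, h_small⟩ := exists_eLpNorm_indicator_le (μ := μ) hp c hε
  have hη_half : (η : ℝ≥0∞) / 2 ≠ 0 := (ENNReal.half_pos (ENNReal.coe_pos.2 hη).ne').ne'
  obtain ⟨K, hKs, hK, -, hμK⟩ := hs.exists_isCompact_isClosed_sdiff_lt hμs hη_half
  obtain ⟨U, hsU, hU, -, hμU⟩ := hs.exists_isOpen_sdiff_lt hμs hη_half
  obtain ⟨θ, hθK, hθU, hθc, hθ01⟩ := exists_continuous_one_zero_of_isCompact hK hU.isClosed_compl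
    (Set.disjoint_compl_right_iff_subset.2 (hKs.trans hsU))
  refine ⟨fun x => θ x • c, ?_, by fun_prop, hθc.smul_right⟩
  have h_diff : μ (U \ K) ≤ η := by
    calc μ (U \ K) ≤ μ (U \ s ∪ s \ K) :=
          measure_mono fun x hx => (em (x ∈ s)).symm.imp (⟨hx.1, ·⟩) (⟨·, hx.2⟩)
      _ ≤ η / 2 + η / 2 := (measure_union_le _ _).trans (add_le_add hμU.le hμK.le)
      _ = η := ENNReal.add_halves _
  refine (eLpNorm_mono fun x => ?_).trans (h_small _ h_diff)
  by_cases hxK : x ∈ K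
  · simp [hθK hxK, hKs hxK]
  by_cases hxU : x ∈ U
  · obtain ⟨h0, h1⟩ := hθ01 x
    rw [Set.indicator_of_mem (show x ∈ U \ K from ⟨hxU, hxK⟩), Pi.sub_apply]
    by_cases hxs : x ∈ s
    · rw [Set.indicator_of_mem hxs, show θ x • c - c = (θ x - 1) • c by simp [sub_smul], norm_smul]
      exact mul_le_of_le_one_left (norm_nonneg c) (abs_le.2 ⟨by linarith, by linarith⟩)
    · rw [Set.indicator_of_notMem hxs, sub_zero, norm_smul]
      exact mul_le_of_le_one_left (norm_nonneg c) (abs_le.2 ⟨by linarith, h1⟩)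
  · have hxs : x ∉ s := fun hxs => hxU (hsU hxs)
    simp [hθU hxU, hxs]

theorem exists_hasCompactSupport_eLpNorm_sub_le (hp : p ≠ ∞) {f : X → E} (hf : MemLp f p μ)
    {ε : ℝ≥0∞} (hε : ε ≠ 0) :
    ∃ g : X → E, eLpNorm (f - g) p μ ≤ ε ∧ Continuous g ∧ HasCompactSupport g := by
  refine hf.induction_dense hp (fun g => Continuous g ∧ HasCompactSupport g) ?_ ?_ ?_ hε
  · exact fun c s hs hμs ε hε =>
      exists_hasCompactSupport_eLpNorm_sub_indicator_le hp c hs hμs.ne hε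
  · exact fun f g hf hg => ⟨hf.1.add hg.1, hf.2.add hg.2⟩
  · exact fun f hf => (hf.1.memLp_of_hasCompactSupport (p := p) hf.2).aestronglyMeasurable

variable (μ) in
theorem dense_setOf_toLp_hasCompactSupport [Fact (1 ≤ p)] (hp : p ≠ ∞) :
    Dense {v : Lp E p μ | ∃ (f : X → E) (hf : MemLp f p μ), Continuous f ∧ HasCompactSupport f ∧
      hf.toLp f = v} := by
  refine Metric.dense_iff.2 fun v ε hε => ?_
  obtain ⟨f, hfv, hf, hfc⟩ := exists_hasCompactSupport_eLpNorm_sub_le hp (Lp.memLp v)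
    (ENNReal.ofReal_pos.2 (half_pos hε)).ne'
  have hf_mem : MemLp f p μ := hf.memLp_of_hasCompactSupport hfc
  refine ⟨hf_mem.toLp f, ?_, f, hf_mem, hf, hfc, rfl⟩
  rw [Metric.mem_ball', Lp.dist_def]
  refine (ENNReal.toReal_le_of_le_ofReal (half_pos hε).le ?_).trans_lt (half_lt_self hε)
  rwa [eLpNorm_congr_ae (hf_mem.coeFn_toLp.mono fun x hx => by simp [hx] :
    ⇑v - ⇑(hf_mem.toLp f) =ᵐ[μ] ⇑v - f)]

end LpDensity

end WeakContainment

/-! ### Temperedness and integrals of correlations -/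

section Temperedness

open ComplexConjugate NNReal Pointwise

variable {G : Type*} [Group G] [TopologicalSpace G] [IsTopologicalGroup G] [MeasurableSpace G]
  [BorelSpace G] (dg : Measure G)

omit [TopologicalSpace G] [IsTopologicalGroup G] [BorelSpace G] in
theorem correlation_nnreal_smul (c : ℝ≥0) (φ : G → ℂ) (g k : G) :
    correlation (c • dg) φ g k = c • correlation dg φ g k :=
  integral_smul_nnreal_measure _ _

theorem continuous_correlation [IsFiniteMeasureOnCompacts dg] {φ : G → ℂ} (hφ : Continuous φ)
    (hφc : HasCompactSupport φ) : Continuous (Function.uncurry (correlation dg φ)) := by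
  refine continuousOn_univ.1 (continuousOn_integral_of_compact_support
    (f := fun (p : G × G) x => conj (φ x) * φ (p.2 * x * p.1)) hφc.isCompact
    (by fun_prop) fun p x _ hx => ?_)
  rw [image_eq_zero_of_notMem_tsupport hx, map_zero, zero_mul]

omit [BorelSpace G] in
theorem exists_isCompact_correlation_eq_zero [LocallyCompactSpace G] {φ : G → ℂ}
    (hφc : HasCompactSupport φ) (g₀ : G) :
    ∃ L : Set G, IsCompact L ∧ ∀ᶠ g in 𝓝 g₀, ∀ k ∉ L, correlation dg φ g k = 0 := by
  obtain ⟨P, hP, hPg₀⟩ := exists_compact_mem_nhds g₀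
  refine ⟨tsupport φ * P⁻¹ * (tsupport φ)⁻¹,
    (hφc.isCompact.mul hP.inv).mul hφc.isCompact.inv, ?_⟩
  filter_upwards [hPg₀] with g hg k hk
  refine integral_eq_zero_of_ae (.of_forall fun x => by_contra fun hne => hk ?_)
  have hx : x ∈ tsupport φ := by
    by_contra hx
    simp [image_eq_zero_of_notMem_tsupport hx] at hne
  refine ⟨k * x, ⟨k * x * g, subset_tsupport _ (right_ne_zero_of_mul hne), g⁻¹,
    Set.inv_mem_inv.2 hg, by group⟩, x⁻¹, Set.inv_mem_inv.2 hx, by group⟩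

theorem diagCoeff_toLp_cosetIntegral [LocallyCompactSpace G] {H : Subgroup G}
    (hH : IsClosed (H : Set G)) {ν : Measure H} [IsFiniteMeasureOnCompacts ν]
    [ν.IsMulRightInvariant] {dg : Measure G} [IsFiniteMeasureOnCompacts dg]
    {μ : Measure (RightCosets H)} [μ.Regular] [SMulInvariantMeasure Gᵐᵒᵖ _ μ]
    (hw : WeilFormula ν dg μ) {φ : G → ℂ} (hφ : Continuous φ) (hφc : HasCompactSupport φ)
    (hφ_mem : MemLp (cosetIntegral ν φ) 2 μ) :
    (rightTranslationRep (G := G) μ).diagCoeff (hφ_mem.toLp _)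
      = fun g => ∫ h : H, correlation dg φ g h ∂ν :=
  funext fun g => (diagCoeff_rightTranslationRep_toLp μ hφ_mem g).trans
    (hw.integral_conj_mul_smul_eq hH hφ hφc g)

variable [T2Space G] [LocallyCompactSpace G] [dg.IsHaarMeasure] [dg.IsMulRightInvariant]
  [dg.Regular] {H : Subgroup G} (hH : IsClosed (H : Set G)) (ν : Measure H) [ν.IsHaarMeasure]
  [ν.IsInvInvariant]

include hH

theorem IsTemperedSubgroup.integral_correlation_mem_weakClosure (h : IsTemperedSubgroup H)
    {φ : G → ℂ} (hφ : Continuous φ) (hφc : HasCompactSupport φ) :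
    (fun g => ∫ h : H, correlation dg φ g h ∂ν)
      ∈ (rightTranslationRep (G := G) dg).weakClosure := by
  obtain ⟨μ, _, _, _, hμ0, h_temp⟩ := h
  obtain ⟨c, hc, hw⟩ := WeilFormula.exists_smul_of_smulInvariantMeasure (ν := ν) (dg := dg) hH hμ0
  have hφ_mem : MemLp (cosetIntegral ν φ) 2 μ :=
    (continuous_cosetIntegral hH hφ hφc).memLp_of_hasCompactSupport
      (hasCompactSupport_cosetIntegral hH hφc)
  have h_coeff : (fun g => ∫ h : H, correlation dg φ g h ∂ν)
      = c⁻¹ • (rightTranslationRep (G := G) μ).diagCoeff (hφ_mem.toLp _) := by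
    rw [diagCoeff_toLp_cosetIntegral hH hw hφ hφc hφ_mem]
    funext g
    simp only [correlation_nnreal_smul, Pi.smul_apply, NNReal.smul_def, integral_smul]
    rw [← NNReal.smul_def, ← NNReal.smul_def, inv_smul_smul₀ hc]
  obtain ⟨v, hv⟩ := (rightTranslationRep (G := G) μ).smul_mem_range_diagCoeff c⁻¹
    (Set.mem_range_self (hφ_mem.toLp _))
  rw [h_coeff, ← hv]
  exact (UnitaryRep.isTempered_iff_weaklyContainedIn dg).1 h_temp v

theorem isTemperedSubgroup_of_integral_correlation_mem_weakClosure
    (h : ∀ φ : G → ℂ, Continuous φ → HasCompactSupport φ →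
      (fun g => ∫ h : H, correlation dg φ g h ∂ν)
        ∈ (rightTranslationRep (G := G) dg).weakClosure) :
    IsTemperedSubgroup H := by
  have := isInvInvariant_of_isMulRightInvariant dg
  obtain ⟨μ, _, hw⟩ := exists_weilFormula (ν := ν) (dg := dg) hH
  have := hw.smulInvariantMeasure hH
  refine ⟨μ, ‹_›, inferInstance, ‹_›, hw.ne_zero,
    (UnitaryRep.isTempered_iff_weaklyContainedIn dg).2 (UnitaryRep.weaklyContainedIn_of_dense
      (dense_setOf_toLp_hasCompactSupport μ ENNReal.ofNat_ne_top) ?_)⟩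
  rintro _ ⟨f, hf_mem, hf, hfc, rfl⟩
  obtain ⟨θ, hθ, hθc, -, hθf⟩ := exists_cosetIntegral_smul_comp_mk_eq (ν := ν) hH hfc
  have hφ : Continuous fun x => θ x • f (RightCosets.mk H x) :=
    hθ.smul (hf.comp RightCosets.continuous_mk)
  revert hf_mem
  rw [← hθf]
  intro hf_mem
  rw [diagCoeff_toLp_cosetIntegral hH hw hφ hθc.smul_right]
  exact h _ hφ hθc.smul_right

end Temperedness

section ChabautyLimit

variable {G : Type*} [Group G] [TopologicalSpace G] [IsTopologicalGroup G] [MeasurableSpace G]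
  [BorelSpace G]

theorem isUnimodularSubgroup_of_discreteTopology (Γ : Subgroup G) [DiscreteTopology Γ] :
    IsUnimodularSubgroup Γ := by
  have : (Measure.count : Measure Γ).IsHaarMeasure :=
    { lt_top_of_isCompact := fun K hK => Measure.count_apply_lt_top.2 hK.finite_of_discrete
      map_mul_left_eq_self := map_mul_left_eq_self _
      open_pos := fun _ _ hne => by simpa using hne.ne_empty }
  exact ⟨Measure.count, inferInstance, inferInstance⟩

theorem mainTheorem5_general [T2Space G] [LocallyCompactSpace G] (Γ : ℕ → Subgroup G)
    (hΓ_closed : ∀ n, IsClosed (Γ n : Set G)) (hΓ_unimodular : ∀ n, IsUnimodularSubgroup (Γ n))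
    (hΓ_tempered : ∀ n, IsTemperedSubgroup (Γ n)) (H : Subgroup G)
    (hH_closed : IsClosed (H : Set G)) (hlim : ChabautyTendsto Γ H) :
    IsUnimodularSubgroup H ∧ IsTemperedSubgroup H := by
  obtain ⟨-, -, -, -, -, dg, _, _, _, _, -⟩ := hΓ_tempered 0
  obtain ⟨V, hVc, hV⟩ := exists_compact_mem_nhds (1 : G)
  choose ν hν_haar hν_inv hνV using fun n =>
    exists_isInvInvariant_preimage_coe_eq_one (hΓ_closed n) (hΓ_unimodular n) hVc hV
  obtain ⟨ν', _, _, hνν'⟩ := hlim.exists_isHaarMeasure_vaguelyTendsto Nat.hyperfilter_le_atTop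
    hΓ_closed hH_closed ν hVc hV hνV
  refine ⟨(isUnimodularSubgroup_iff_exists_isInvInvariant hH_closed).2 ⟨ν', ‹_›, ‹_›⟩,
    isTemperedSubgroup_of_integral_correlation_mem_weakClosure dg hH_closed ν' fun φ hφ hφc => ?_⟩
  have h_unif (Q : Set G) (hQ : IsCompact Q) :
      TendstoUniformlyOn (fun n g => ∫ γ : Γ n, correlation dg φ g γ ∂ν n)
        (fun g => ∫ h : H, correlation dg φ g h ∂ν') (hyperfilter ℕ) Q := by
    have := isFiniteMeasureOnCompacts_map_coe hH_closed ν'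
    have := hνν'.tendstoUniformlyOn_integral
      (boundedOnCompacts_map_coe hΓ_closed ν hV (C := 1) fun n => (hνV n).le)
      (continuous_correlation dg hφ hφc) (exists_isCompact_correlation_eq_zero dg hφc) hQ
    simpa only [(measurableEmbedding_coe _).integral_map, hΓ_closed, hH_closed] using this
  exact UnitaryRep.mem_weakClosure_of_tendstoUniformlyOn (.of_forall fun n =>
    (hΓ_tempered n).integral_correlation_mem_weakClosure dg (hΓ_closed n) (ν n) hφ hφc) h_unif

end ChabautyLimit

end

theorem mainTheorem5 {G : Type*} [Group G] [TopologicalSpace G] [IsTopologicalGroup G]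
    [MeasurableSpace G] [BorelSpace G]
    (hG : IsConnectedSemisimpleRealAlgebraicGroup G)
    (Γ : ℕ → Subgroup G) (hΓ_discrete : ∀ n, DiscreteTopology (Γ n))
    (hΓ_tempered : ∀ n, IsTemperedSubgroup (Γ n))
    (H : Subgroup G) (hH_closed : IsClosed (H : Set G)) (hlim : ChabautyTendsto Γ H) :
    IsUnimodularSubgroup H ∧ IsTemperedSubgroup H := by
  have := hG.t2Space
  have := hG.locallyCompactSpace
  exact mainTheorem5_general Γ (fun _ => Subgroup.isClosed_of_discrete)
    (fun n => isUnimodularSubgroup_of_discreteTopology (Γ n)) hΓ_tempered H hH_closed hlim
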